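/- **Setting.** Let $r,s,m\ge 1$ be integers, $I_r=\{1,\dots,r\}$, $I_s=\{1,\dots,s\}$, $I_{r,s}=I_r\times I_s$. For $x\in\mathbb R^{r\times s}$ let $\mathrm{vec}(x)\in\mathbb R^{rs}$ be its column-major vectorization. For target margins $a\in(0,1]^r$, $b\in(0,1]^s$, each summing to one, put $\mathcal R_a(x)_{ij}=a_ix_{ij}/\sum_{j'}x_{ij'}$ and $\mathcal C_b(x)_{ij}=b_jx_{ij}/\sum_{i'}x_{i'j}$. The iterative proportional fitting procedure (IPFP) started at $x$ is the sequence with $2N$-th term $(\mathcal C_b\circ\mathcal R_a)^{N}(x)$ and $(2N+1)$-th term $\mathcal R_a\circ(\mathcal C_b\circ\mathcal R_a)^{N}(x)$; its limit, if it exists, is denoted $\mathcal I_{a,b}(x)$. Let $\mathcal U(x)=\mathcal I_{a,b}(x)$ for the uniform margins $a\equiv1/r$, $b\equiv 1/s$. A copula p.m.f. is a bivariate p.m.f. on $I_{r,s}$ with uniform margins. Let $(X_1,Y_1),(X_2,Y_2),\dots$ be (not necessarily independent) copies of a random vector $(X,Y)$ with p.m.f. $p$ on $I_{r,s}$, where $p_{ij}>0$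 for all $(i,j)$. Let $\Theta\subset\mathbb R^m$ be open and let $\{u^{[\theta]}:\theta\in\Theta\}$ be a family of copula p.m.f.s with $u^{[\theta]}_{ij}>0$ for all $\theta\in\Theta$ and $(i,j)\in I_{r,s}$. Assume that, for some $\theta_0\in\Theta$, $u=u^{[\theta_0]}$ is the copula p.m.f. of $p$, that is, the IPFP started at $u$ with the margins of $p$ as target margins converges to $p$. Let $$\hat p^{[n]}_{ij}=\frac1n\sum_{k=1}^n\mathbf 1(X_k=i,Y_k=j),\qquad p^{[n]}_{ij}=\frac1{n+1}\Big\{\sum_{k=1}^n\mathbf 1(X_k=i,Y_k=j)+\frac1{rs}\Big\},\qquad u^{[n]}=\mathcal U(p^{[n]}),$$ and, for each $n\ge1$, let the random vector $\theta^{[n]}\in\Theta$ almost surely be a maximizer over $\Theta$ of the log-pseudo-likelihood $\bar L^{[n]}(\theta)=n\sum_{(i,j)\in I_{r,s}}u^{[n]}_{ij}\log u^{[\theta]}_{ij}$. Write $\ell^{[\theta]}_{ij}=\log u^{[\theta]}_{ij}$, let $\dot\ell^{[\theta]}_{ij}\in\mathbb R^m$ and $\ddot\ell^{[\theta]}_{ij}\in\mathbb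 R^{m\times m}$ be its gradient and Hessian in $\theta$, and let $\dot\ell^{[\theta]}$ be the $m\times rs$ matrix whose column $i+r(j-1)$ is $\dot\ell^{[\theta]}_{ij}$. Put $$F=\mathbb E_{\theta_0}\big(\dot\ell^{[\theta_0]}_{(U,V)}\dot\ell^{[\theta_0],\top}_{(U,V)}\big),$$ where $(U,V)$ has p.m.f. $u^{[\theta_0]}$ under $\mathbb E_{\theta_0}$, and $\Sigma_p=\mathrm{diag}\{\mathrm{vec}(p)\}-\mathrm{vec}(p)\mathrm{vec}(p)^\top$. Finally let $J_{u,p}=-K L_u^{-1}M_pN\in\mathbb R^{rs\times rs}$, where * $K$ is the $rs\times(r-1)(s-1)$ block matrix whose first $s-1$ block rows form the block diagonal matrix with diagonal blocks $H$ and whose last block row is $(-H,\dots,-H)$, with $H\in\mathbb R^{r\times(r-1)}$ the identity matrix of size $r-1$ above a row of $-1$'s; * $L_u$ is the square matrix of size $(r-1)(s-1)$ whose entry at row $k+(r-1)(l-1)$ and column $i+(r-1)(j-1)$ ($k,i\le r-1$, $l,j\le s-1$) is $$\frac{\mathbf 1(i=k,j=l)}{u_{kl}}+\frac{\mathbf 1(j=l)}{s^{-1}-\sum_{g=1}^{r-1}u_{gl}}+\frac{\mathbf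 1(i=k)}{r^{-1}-\sum_{h=1}^{s-1}u_{kh}}+\frac1{r^{-1}+s^{-1}-1+\sum_{g=1}^{r-1}\sum_{h=1}^{s-1}u_{gh}};$$ * $M_p$ is the $(r-1)(s-1)\times(rs-1)$ matrix whose entry at row $k+(r-1)(l-1)$ ($k\le r-1$, $l\le s-1$) and column $i+r(j-1)$, $(i,j)\in I_{r,s}\setminus\{(r,s)\}$, is $$-\frac{\mathbf 1(i=k,j=l)}{p_{kl}}+\frac{\mathbf 1(i=r,j=l)}{p_{rl}}+\frac{\mathbf 1(i=k,j=s)}{p_{ks}}+\frac1{1-\sum_{(g,h)\ne(r,s)}p_{gh}};$$ * $N$ is the $(rs-1)\times rs$ matrix that deletes the last coordinate. **Proposition 3.6.** Assume that $\theta^{[n]}\to\theta_0$ in probability, that for every $(i,j)\in I_{r,s}$ the map $\theta\mapsto\ell^{[\theta]}_{ij}$ is twice differentiable at every $\theta\in\Theta$, and that the matrix $\mathbb E_{\theta_0}(\ddot\ell^{[\theta_0]}_{(U,V)})$ is invertible. Then $L_u$ and $F$ are invertible, and: 1. if $\sqrt n(\hat p^{[n]}-p)$ converges weakly in $\mathbb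 R^{r\times s}$ to some random matrix $Z_p$, then $$\sqrt n(\theta^{[n]}-\theta_0)=F^{-1}\,\dot\ell^{[\theta_0]}J_{u,p}\,\sqrt n\,\mathrm{vec}(\hat p^{[n]}-p)+o_P(1);$$ 2. consequently, if $(X_1,Y_1),(X_2,Y_2),\dots$ are independent, then $\sqrt n(\theta^{[n]}-\theta_0)$ converges weakly to the centered normal distribution on $\mathbb R^m$ with covariance matrix $$F^{-1}\,\dot\ell^{[\theta_0]}J_{u,p}\,\Sigma_p\,J_{u,p}^\top\,\dot\ell^{[\theta_0],\top}\,(F^{-1})^\top .$$ -/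

import Mathlib

open MeasureTheory ProbabilityTheory Filter Topology

/-!
Bivariate p.m.f.s with `r = R + 1` rows and `s = S + 1` columns are real matrices indexed by
`Fin (R + 1)` and `Fin (S + 1)`; thus `r, s ≥ 1`, the last row index `r` is `Fin.last R`, and the
row indices `1, …, r - 1` are `Fin.castSucc k` with `k : Fin R` (similarly for columns).
Vectorization is Mathlib's column-major `Matrix.vec`, whose entries are indexed by the pairs
(column, row).
-/

namespace CopulaPMF

noncomputable section

/-! ### The iterative proportional fitting procedure -/

/-- Rescale the rows of `x` so that the row sums become `a`. -/
def rowScale {ι κ : Type*} [Fintype κ] (a : ι → ℝ) (x : Matrix ι κ ℝ) : Matrix ι κ ℝ :=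
  Matrix.of fun i j => a i * x i j / ∑ j', x i j'

/-- Rescale the columns of `x` so that the column sums become `b`. -/
def colScale {ι κ : Type*} [Fintype ι] (b : κ → ℝ) (x : Matrix ι κ ℝ) : Matrix ι κ ℝ :=
  Matrix.of fun i j => b j * x i j / ∑ i', x i' j

/-- The `n`-th step of the procedure with target margins `a` and `b`, starting from `x`: the
`2N`-th step is `(C_b ∘ R_a)^N` and the `(2N+1)`-th step is `R_a ∘ (C_b ∘ R_a)^N`. -/
def ipfpStep {ι κ : Type*} [Fintype ι] [Fintype κ] (a : ι → ℝ) (b : κ → ℝ) (n : ℕ)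
    (x : Matrix ι κ ℝ) : Matrix ι κ ℝ :=
  if Even n then (colScale b ∘ rowScale a)^[n / 2] x
  else rowScale a ((colScale b ∘ rowScale a)^[n / 2] x)

/-- The procedure with target margins `a`, `b` started at `x` converges and its limit is `y`. -/
def IPFPTendsto {ι κ : Type*} [Fintype ι] [Fintype κ] (a : ι → ℝ) (b : κ → ℝ)
    (x y : Matrix ι κ ℝ) : Prop :=
  Tendsto (fun n => ipfpStep a b n x) atTop (𝓝 y)

/-- The limit of the procedure (meaningful when it converges, which is the case for every
matrix with strictly positive entries and target margins of the same total mass). -/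
def ipfp {ι κ : Type*} [Fintype ι] [Fintype κ] (a : ι → ℝ) (b : κ → ℝ)
    (x : Matrix ι κ ℝ) : Matrix ι κ ℝ :=
  limUnder atTop (fun n => ipfpStep a b n x)

variable {R S m : ℕ}

/-- First univariate margin (row sums). -/
def margin₁ (x : Matrix (Fin (R + 1)) (Fin (S + 1)) ℝ) : Fin (R + 1) → ℝ :=
  fun i => ∑ j, x i j

/-- Second univariate margin (column sums). -/
def margin₂ (x : Matrix (Fin (R + 1)) (Fin (S + 1)) ℝ) : Fin (S + 1) → ℝ :=
  fun j => ∑ i, x i j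

/-- The uniform p.m.f. on `n + 1` points. -/
def unif (n : ℕ) : Fin (n + 1) → ℝ := fun _ => 1 / ((n : ℝ) + 1)

/-- A copula p.m.f.: a bivariate p.m.f. with uniform margins (its total mass is then one). -/
structure IsCopulaPMF (u : Matrix (Fin (R + 1)) (Fin (S + 1)) ℝ) : Prop where
  nonneg : ∀ i j, 0 ≤ u i j
  margin₁_eq : margin₁ u = unif R
  margin₂_eq : margin₂ u = unif S

/-- `u` is the copula p.m.f. of `p`: it has uniform margins, and the iterative proportional
fitting procedure started at `u`, with target margins those of `p`, converges to `p`. -/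
structure IsCopulaPMFOf (u p : Matrix (Fin (R + 1)) (Fin (S + 1)) ℝ) : Prop where
  isCopula : IsCopulaPMF u
  tendsto : IPFPTendsto (margin₁ p) (margin₂ p) u p

/-- The map `𝓤`: the procedure with uniform target margins. -/
def toCopula (x : Matrix (Fin (R + 1)) (Fin (S + 1)) ℝ) :
    Matrix (Fin (R + 1)) (Fin (S + 1)) ℝ :=
  ipfp (unif R) (unif S) x

/-! ### The matrix `J_{u,p}` -/

/-- The `r × (r - 1)` matrix `H`: an identity matrix above a row of `-1`. -/
def Hmat (R : ℕ) : Matrix (Fin (R + 1)) (Fin R) ℝ :=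
  Matrix.of fun i k => if i = Fin.last R then -1 else if i = k.castSucc then 1 else 0

/-- The `rs × (r - 1)(s - 1)` block matrix `K`: a block diagonal matrix with `s - 1` diagonal
blocks `H`, above a row of blocks `-H`. -/
def Kmat (R S : ℕ) : Matrix (Fin (S + 1) × Fin (R + 1)) (Fin S × Fin R) ℝ :=
  Matrix.of fun q c =>
    if q.1 = Fin.last S then -Hmat R q.2 c.2
    else if q.1 = c.1.castSucc then Hmat R q.2 c.2 else 0

/-- The matrix `L_u`, with rows indexed by `(l, k)` and columns by `(j, i)`. -/
def Lmat (u : Matrix (Fin (R + 1)) (Fin (S + 1)) ℝ) :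
    Matrix (Fin S × Fin R) (Fin S × Fin R) ℝ :=
  Matrix.of fun (l, k) (j, i) =>
    (if i = k ∧ j = l then 1 else 0) / u k.castSucc l.castSucc
      + (if j = l then 1 else 0) / (1 / ((S : ℝ) + 1) - ∑ g : Fin R, u g.castSucc l.castSucc)
      + (if i = k then 1 else 0) / (1 / ((R : ℝ) + 1) - ∑ h : Fin S, u k.castSucc h.castSucc)
      + 1 / (1 / ((R : ℝ) + 1) + 1 / ((S : ℝ) + 1) - 1
          + ∑ g : Fin R, ∑ h : Fin S, u g.castSucc h.castSucc)

/-- The vectorized positions (column, row) other than the last one. -/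
abbrev ButLast (R S : ℕ) : Type :=
  {q : Fin (S + 1) × Fin (R + 1) // q ≠ (Fin.last S, Fin.last R)}

/-- The matrix `M_p`, with rows indexed by `(l, k)` and columns by `(j, i) ≠ (s, r)`. -/
def Mmat (p : Matrix (Fin (R + 1)) (Fin (S + 1)) ℝ) :
    Matrix (Fin S × Fin R) (ButLast R S) ℝ :=
  Matrix.of fun (l, k) ⟨(j, i), _⟩ =>
    -((if i = k.castSucc ∧ j = l.castSucc then 1 else 0) / p k.castSucc l.castSucc)
      + (if i = Fin.last R ∧ j = l.castSucc then 1 else 0) / p (Fin.last R) l.castSucc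
      + (if i = k.castSucc ∧ j = Fin.last S then 1 else 0) / p k.castSucc (Fin.last S)
      + 1 / (1 - ∑ q : ButLast R S, p q.1.2 q.1.1)

/-- The `(rs - 1) × rs` matrix `N` that deletes the last coordinate. -/
def Nmat (R S : ℕ) : Matrix (ButLast R S) (Fin (S + 1) × Fin (R + 1)) ℝ :=
  Matrix.of fun b q => if b.1 = q then 1 else 0

/-- `J_{u,p} = - K L_u⁻¹ M_p N`. -/
def Jmat (u p : Matrix (Fin (R + 1)) (Fin (S + 1)) ℝ) :
    Matrix (Fin (S + 1) × Fin (R + 1)) (Fin (S + 1) × Fin (R + 1)) ℝ :=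
  -(Kmat R S * (Lmat u)⁻¹ * Mmat p * Nmat R S)

/-- `Σ_p = diag(vec p) - vec p (vec p)ᵀ`. -/
def covMat (p : Matrix (Fin (R + 1)) (Fin (S + 1)) ℝ) :
    Matrix (Fin (S + 1) × Fin (R + 1)) (Fin (S + 1) × Fin (R + 1)) ℝ :=
  Matrix.diagonal (Matrix.vec p) - Matrix.vecMulVec (Matrix.vec p) (Matrix.vec p)

/-! ### Estimators -/

/-- The empirical p.m.f. of the first `n` observations `(X 0, Y 0), …, (X (n-1), Y (n-1))`. -/
def empPMF {Ω : Type*} (X : ℕ → Ω → Fin (R + 1)) (Y : ℕ → Ω → Fin (S + 1)) (n : ℕ) (ω : Ω) :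
    Matrix (Fin (R + 1)) (Fin (S + 1)) ℝ :=
  Matrix.of fun i j =>
    1 / (n : ℝ) * ∑ k ∈ Finset.range n, if X k ω = i ∧ Y k ω = j then 1 else 0

/-- The smoothed empirical p.m.f. -/
def smoothPMF {Ω : Type*} (X : ℕ → Ω → Fin (R + 1)) (Y : ℕ → Ω → Fin (S + 1)) (n : ℕ) (ω : Ω) :
    Matrix (Fin (R + 1)) (Fin (S + 1)) ℝ :=
  Matrix.of fun i j =>
    1 / ((n : ℝ) + 1) * ((∑ k ∈ Finset.range n, if X k ω = i ∧ Y k ω = j then 1 else 0)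
      + 1 / (((R : ℝ) + 1) * ((S : ℝ) + 1)))

/-- The empirical copula p.m.f. -/
def empCopula {Ω : Type*} (X : ℕ → Ω → Fin (R + 1)) (Y : ℕ → Ω → Fin (S + 1)) (n : ℕ) (ω : Ω) :
    Matrix (Fin (R + 1)) (Fin (S + 1)) ℝ :=
  toCopula (smoothPMF X Y n ω)

/-- The log-pseudo-likelihood of the family `u`. -/
def logPseudoLik {Ω : Type*}
    (u : EuclideanSpace ℝ (Fin m) → Matrix (Fin (R + 1)) (Fin (S + 1)) ℝ)
    (X : ℕ → Ω → Fin (R + 1)) (Y : ℕ → Ω → Fin (S + 1)) (n : ℕ) (ω : Ω)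
    (θ : EuclideanSpace ℝ (Fin m)) : ℝ :=
  n * ∑ i, ∑ j, empCopula X Y n ω i j * Real.log (u θ i j)

/-! ### Score, Fisher information and expected Hessian -/

/-- The log-probability `ℓ_{ij}` as a function of the parameter. -/
def logProb (u : EuclideanSpace ℝ (Fin m) → Matrix (Fin (R + 1)) (Fin (S + 1)) ℝ)
    (i : Fin (R + 1)) (j : Fin (S + 1)) (θ : EuclideanSpace ℝ (Fin m)) : ℝ :=
  Real.log (u θ i j)

/-- The partial derivative `∂ f / ∂ θ_k` of a differentiable function. -/
def partialD (k : Fin m) (f : EuclideanSpace ℝ (Fin m) → ℝ) (θ : EuclideanSpace ℝ (Fin m)) : ℝ :=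
  fderiv ℝ f θ (EuclideanSpace.single k 1)

/-- The gradient of the log-probability `ℓ_{ij}`. -/
def score (u : EuclideanSpace ℝ (Fin m) → Matrix (Fin (R + 1)) (Fin (S + 1)) ℝ)
    (θ : EuclideanSpace ℝ (Fin m)) (i : Fin (R + 1)) (j : Fin (S + 1)) : Fin m → ℝ :=
  fun k => partialD k (logProb u i j) θ

/-- The Hessian matrix of the log-probability `ℓ_{ij}`. -/
def hessian (u : EuclideanSpace ℝ (Fin m) → Matrix (Fin (R + 1)) (Fin (S + 1)) ℝ)
    (θ : EuclideanSpace ℝ (Fin m)) (i : Fin (R + 1)) (j : Fin (S + 1)) :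
    Matrix (Fin m) (Fin m) ℝ :=
  Matrix.of fun k l => partialD k (partialD l (logProb u i j)) θ

/-- The matrix with columns the gradients of the log-probabilities, in column-major order. -/
def scoreMatrix (u : EuclideanSpace ℝ (Fin m) → Matrix (Fin (R + 1)) (Fin (S + 1)) ℝ)
    (θ : EuclideanSpace ℝ (Fin m)) : Matrix (Fin m) (Fin (S + 1) × Fin (R + 1)) ℝ :=
  Matrix.of fun k q => score u θ q.2 q.1 k

/-- The expected Hessian: the expectation of `hessian u θ U V` when `(U, V)` has p.m.f. `u θ`. -/
def expHessian (u : EuclideanSpace ℝ (Fin m) → Matrix (Fin (R + 1)) (Fin (S + 1)) ℝ)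
    (θ : EuclideanSpace ℝ (Fin m)) : Matrix (Fin m) (Fin m) ℝ :=
  ∑ i, ∑ j, u θ i j • hessian u θ i j

/-- The Fisher information: the expectation of the outer product of the score with itself when
`(U, V)` has p.m.f. `u θ`. -/
def fisher (u : EuclideanSpace ℝ (Fin m) → Matrix (Fin (R + 1)) (Fin (S + 1)) ℝ)
    (θ : EuclideanSpace ℝ (Fin m)) : Matrix (Fin m) (Fin m) ℝ :=
  ∑ i, ∑ j, u θ i j • Matrix.vecMulVec (score u θ i j) (score u θ i j)

end

end CopulaPMF

open CopulaPMF

namespace CopulaPMF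

noncomputable section

variable {R S m : ℕ}

/-! ### Log odds ratios -/

/-! The proof rests on two facts: row and column scalings preserve odds ratios, and a strictly
positive matrix is determined by its margins together with its odds ratios (`eq_of_logOdds_eq`).
Once the fitting procedure is known to converge (`exists_ipfpTendsto`), `toCopula x` is therefore
the unique positive copula p.m.f. with the odds ratios of `x`, and `u θ₀` has the odds ratios of
`p`.

In coordinates, `Kᵀ log(vec x)` lists the log odds ratios, while `vec u + K z` keeps the margins of
`u`. Near `p`, `toCopula` is thus `x ↦ u + K g(Kᵀ log x)`, where `g` is the local inverse of `G z =
Kᵀ log(u + K z)`. The derivative of `G` at zero is `Kᵀ diag(1/u) K = L_u`, which is positive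
definite. So `toCopula` has derivative `K L_u⁻¹ Kᵀ diag(1/p)`, which equals `J_{u,p}` on vectors of
total mass zero (`toCopula_sub_isLittleO`).

At an interior maximizer the score averaged against the empirical copula vanishes. Linearize this at
`θ₀`, where the expected score is zero and the expected Hessian is `-F`. With `W` the score matrix
this gives `F (θ - θ₀) = W (u_n - u) + o(‖θ - θ₀‖)`, hence a purely deterministic expansion in terms
of `x - p` (`sub_isLittleO_of_scoreEq`). Only differentiability of the score at `θ₀` enters the
linearization, not continuity of the Hessian.

Consistency and boundedness in probability of `√n (p̂ - p)` turn this into the stochastic expansion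
(`tendstoInMeasure_sqrt_smul_sub`); smoothing costs at most `1/n`. Under independence, the central
limit theorem and Slutsky's lemma give the normal limit. -/

/-- The logarithms of the odds ratios of `x` with respect to the last row and the last column. -/
def logOdds (x : Matrix (Fin (R + 1)) (Fin (S + 1)) ℝ) : Matrix (Fin (R + 1)) (Fin (S + 1)) ℝ :=
  Matrix.of fun i j => Real.log (x i j) + Real.log (x (Fin.last R) (Fin.last S))
    - Real.log (x i (Fin.last S)) - Real.log (x (Fin.last R) j)

/-- A row factor and a column factor each occur once with either sign in the alternating sum of
logarithms, so they cancel. -/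
lemma logOdds_scale {x y : Matrix (Fin (R + 1)) (Fin (S + 1)) ℝ} {α : Fin (R + 1) → ℝ}
    {β : Fin (S + 1) → ℝ} (hα : ∀ i, 0 < α i) (hβ : ∀ j, 0 < β j) (hx : ∀ i j, 0 < x i j)
    (h : ∀ i j, y i j = α i * β j * x i j) : logOdds y = logOdds x := by
  have hlog : ∀ i j, Real.log (y i j) = Real.log (α i) + Real.log (β j) + Real.log (x i j) := by
    intro i j
    rw [h, Real.log_mul (mul_pos (hα i) (hβ j)).ne' (hx i j).ne',
      Real.log_mul (hα i).ne' (hβ j).ne']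
  ext i j
  simp only [logOdds, Matrix.of_apply, hlog]
  ring

lemma continuousAt_logOdds {x : Matrix (Fin (R + 1)) (Fin (S + 1)) ℝ} (hx : ∀ i j, 0 < x i j) :
    ContinuousAt logOdds x := by
  have hlog : ∀ i j, ContinuousAt
      (fun y : Matrix (Fin (R + 1)) (Fin (S + 1)) ℝ => Real.log (y i j)) x := fun i j =>
    (continuous_id.matrix_elem i j).continuousAt.log (hx i j).ne'
  refine continuousAt_pi.2 fun i => continuousAt_pi.2 fun j => ?_
  exact (((hlog _ _).add (hlog _ _)).sub (hlog _ _)).sub (hlog _ _)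

/-- A strictly positive matrix is determined by its margins and its odds ratios. -/
lemma eq_of_logOdds_eq {y z : Matrix (Fin (R + 1)) (Fin (S + 1)) ℝ} (hy : ∀ i j, 0 < y i j)
    (hz : ∀ i j, 0 < z i j) (h₁ : margin₁ y = margin₁ z) (h₂ : margin₂ y = margin₂ z)
    (h : logOdds y = logOdds z) : y = z := by
  have hd : ∀ i j, Real.log (y i j) - Real.log (z i j) =
      (Real.log (y i (Fin.last S)) - Real.log (z i (Fin.last S)))
      + ((Real.log (y (Fin.last R) j) - Real.log (z (Fin.last R) j))
        - (Real.log (y (Fin.last R) (Fin.last S)) - Real.log (z (Fin.last R) (Fin.last S)))) := by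
    intro i j
    have := congrFun (congrFun h i) j
    simp only [logOdds, Matrix.of_apply] at this
    linarith
  -- The logarithm is increasing, so both factors have the same sign.
  have hnn : ∀ i j, 0 ≤ (y i j - z i j) * (Real.log (y i j) - Real.log (z i j)) := by
    intro i j
    rcases le_total (y i j) (z i j) with hle | hle
    · exact mul_nonneg_of_nonpos_of_nonpos (sub_nonpos.2 hle)
        (sub_nonpos.2 (Real.log_le_log (hy i j) hle))
    · exact mul_nonneg (sub_nonneg.2 hle) (sub_nonneg.2 (Real.log_le_log (hz i j) hle))
  have hr : ∀ i, ∑ j, (y i j - z i j) = 0 := fun i => by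
    rw [Finset.sum_sub_distrib]
    exact sub_eq_zero.2 (congrFun h₁ i)
  have hc : ∀ j, ∑ i, (y i j - z i j) = 0 := fun j => by
    rw [Finset.sum_sub_distrib]
    exact sub_eq_zero.2 (congrFun h₂ j)
  have hsum : ∑ i, ∑ j, (y i j - z i j) * (Real.log (y i j) - Real.log (z i j)) = 0 := by
    -- By `hd` the log difference is a function of the row plus a function of the column; pairing it
    -- with a matrix whose row and column sums vanish gives zero.
    rw [Finset.sum_congr rfl fun i _ => Finset.sum_congr rfl fun j _ =>
      (congrArg ((y i j - z i j) * ·) (hd i j)).trans (mul_add _ _ _)]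
    simp_rw [Finset.sum_add_distrib]
    rw [add_eq_zero_iff_eq_neg, Finset.sum_comm (f := fun i j => (y i j - z i j)
      * (Real.log (y (Fin.last R) j) - Real.log (z (Fin.last R) j)
        - (Real.log (y (Fin.last R) (Fin.last S)) - Real.log (z (Fin.last R) (Fin.last S)))))]
    simp_rw [← Finset.sum_mul, hr, hc]
    simp
  rw [Finset.sum_eq_zero_iff_of_nonneg fun i _ => Finset.sum_nonneg fun j _ => hnn i j] at hsum
  ext i j
  have := (Finset.sum_eq_zero_iff_of_nonneg fun j _ => hnn i j).1 (hsum i (Finset.mem_univ _)) j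
    (Finset.mem_univ _)
  rcases mul_eq_zero.1 this with h0 | h0
  · linarith
  · exact Real.strictMonoOn_log.injOn (hy i j) (hz i j) (sub_eq_zero.1 h0)

/-! ### Elementary properties of the scalings -/

lemma rowScale_apply (a : Fin (R + 1) → ℝ) (x : Matrix (Fin (R + 1)) (Fin (S + 1)) ℝ) (i j) :
    rowScale a x i j = a i / (∑ j', x i j') * 1 * x i j := by
  simp only [rowScale, Matrix.of_apply]
  ring

lemma colScale_apply (b : Fin (S + 1) → ℝ) (x : Matrix (Fin (R + 1)) (Fin (S + 1)) ℝ) (i j) :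
    colScale b x i j = 1 * (b j / (∑ i', x i' j)) * x i j := by
  simp only [colScale, Matrix.of_apply]
  ring

section Scaling

variable {a : Fin (R + 1) → ℝ} {b : Fin (S + 1) → ℝ} {x : Matrix (Fin (R + 1)) (Fin (S + 1)) ℝ}

lemma rowSum_pos (hx : ∀ i j, 0 < x i j) (i : Fin (R + 1)) : 0 < ∑ j, x i j :=
  Finset.sum_pos (fun j _ => hx i j) Finset.univ_nonempty

lemma colSum_pos (hx : ∀ i j, 0 < x i j) (j : Fin (S + 1)) : 0 < ∑ i, x i j :=
  Finset.sum_pos (fun i _ => hx i j) Finset.univ_nonempty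

lemma rowScale_pos (ha : ∀ i, 0 < a i) (hx : ∀ i j, 0 < x i j) (i j) : 0 < rowScale a x i j :=
  div_pos (mul_pos (ha i) (hx i j)) (rowSum_pos hx i)

lemma colScale_pos (hb : ∀ j, 0 < b j) (hx : ∀ i j, 0 < x i j) (i j) : 0 < colScale b x i j :=
  div_pos (mul_pos (hb j) (hx i j)) (colSum_pos hx j)

lemma logOdds_rowScale (ha : ∀ i, 0 < a i) (hx : ∀ i j, 0 < x i j) :
    logOdds (rowScale a x) = logOdds x :=
  logOdds_scale (fun i => div_pos (ha i) (rowSum_pos hx i)) (fun _ => one_pos) hx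
    (rowScale_apply a x)

lemma logOdds_colScale (hb : ∀ j, 0 < b j) (hx : ∀ i j, 0 < x i j) :
    logOdds (colScale b x) = logOdds x :=
  logOdds_scale (fun _ => one_pos) (fun j => div_pos (hb j) (colSum_pos hx j)) hx
    (colScale_apply b x)

lemma rowScale_rowSum (hx : ∀ i j, 0 < x i j) (i : Fin (R + 1)) :
    ∑ j, rowScale a x i j = a i := by
  simp_rw [rowScale, Matrix.of_apply, ← Finset.sum_div, ← Finset.mul_sum]
  exact mul_div_cancel_right₀ _ (rowSum_pos hx i).ne'

lemma colScale_colSum (hx : ∀ i j, 0 < x i j) (j : Fin (S + 1)) :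
    ∑ i, colScale b x i j = b j := by
  simp_rw [colScale, Matrix.of_apply, ← Finset.sum_div, ← Finset.mul_sum]
  exact mul_div_cancel_right₀ _ (colSum_pos hx j).ne'

lemma iterate_pos (ha : ∀ i, 0 < a i) (hb : ∀ j, 0 < b j) (hx : ∀ i j, 0 < x i j) (N : ℕ) :
    ∀ i j, 0 < (colScale b ∘ rowScale a)^[N] x i j := by
  induction N with
  | zero => exact hx
  | succ N ih =>
    rw [Function.iterate_succ_apply']
    exact colScale_pos hb (rowScale_pos ha ih)

lemma logOdds_iterate (ha : ∀ i, 0 < a i) (hb : ∀ j, 0 < b j) (hx : ∀ i j, 0 < x i j) (N : ℕ) :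
    logOdds ((colScale b ∘ rowScale a)^[N] x) = logOdds x := by
  induction N with
  | zero => rfl
  | succ N ih =>
    rw [Function.iterate_succ_apply', Function.comp_apply,
      logOdds_colScale hb (rowScale_pos ha (iterate_pos ha hb hx N)),
      logOdds_rowScale ha (iterate_pos ha hb hx N), ih]

lemma logOdds_ipfpStep (ha : ∀ i, 0 < a i) (hb : ∀ j, 0 < b j) (hx : ∀ i j, 0 < x i j) (n : ℕ) :
    logOdds (ipfpStep a b n x) = logOdds x := by
  rw [ipfpStep]
  split_ifs
  · exact logOdds_iterate ha hb hx _
  · rw [logOdds_rowScale ha (iterate_pos ha hb hx _), logOdds_iterate ha hb hx _]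

/-- Odds ratios are constant along the procedure, and they pass to the limit because the limit is
positive, where `logOdds` is continuous. -/
lemma logOdds_eq_of_ipfpTendsto {y : Matrix (Fin (R + 1)) (Fin (S + 1)) ℝ} (ha : ∀ i, 0 < a i)
    (hb : ∀ j, 0 < b j) (hx : ∀ i j, 0 < x i j) (hy : ∀ i j, 0 < y i j)
    (h : IPFPTendsto a b x y) : logOdds y = logOdds x := by
  have h1 := (continuousAt_logOdds hy).tendsto.comp h
  refine tendsto_nhds_unique h1 ?_
  simp only [Function.comp_def, logOdds_ipfpStep ha hb hx]
  exact tendsto_const_nhds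

/-! ### Convergence of the procedure -/

/-- One term of Gibbs' inequality. -/
lemma sub_le_mul_log_div {s t : ℝ} (hs : 0 < s) (ht : 0 < t) :
    s - t ≤ s * Real.log (s / t) := by
  have := Real.log_le_sub_one_of_pos (div_pos ht hs)
  rw [← inv_div, Real.log_inv] at this
  have h2 := mul_le_mul_of_nonneg_left this hs.le
  have h3 : s * ((s / t)⁻¹ - 1) = t - s := by field_simp
  linarith

lemma eq_of_mul_log_div_eq {s t : ℝ} (hs : 0 < s) (ht : 0 < t)
    (h : s * Real.log (s / t) = s - t) : s = t := by
  by_contra hne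
  have := Real.log_lt_sub_one_of_pos (div_pos ht hs)
    (fun h1 => hne ((div_eq_one_iff_eq hs.ne').1 h1).symm)
  rw [← inv_div, Real.log_inv] at this
  have h2 := mul_lt_mul_of_pos_left this hs
  have h3 : s * ((s / t)⁻¹ - 1) = t - s := by field_simp
  linarith

lemma sum_mul_log_div_nonneg {ι : Type*} [Fintype ι] {s t : ι → ℝ} (hs : ∀ i, 0 < s i)
    (ht : ∀ i, 0 < t i) (h : ∑ i, s i = ∑ i, t i) : 0 ≤ ∑ i, s i * Real.log (s i / t i) := by
  have : ∑ i, (s i - t i) ≤ ∑ i, s i * Real.log (s i / t i) :=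
    Finset.sum_le_sum fun i _ => sub_le_mul_log_div (hs i) (ht i)
  rwa [Finset.sum_sub_distrib, h, sub_self] at this

/-- The equality case of Gibbs' inequality. -/
lemma eq_of_sum_mul_log_div_eq_zero {ι : Type*} [Fintype ι] {s t : ι → ℝ} (hs : ∀ i, 0 < s i)
    (ht : ∀ i, 0 < t i) (h : ∑ i, s i = ∑ i, t i) (h0 : ∑ i, s i * Real.log (s i / t i) = 0)
    (i : ι) : s i = t i := by
  have h1 : ∑ i, (s i * Real.log (s i / t i) - (s i - t i)) = 0 := by
    rw [Finset.sum_sub_distrib, Finset.sum_sub_distrib, h0, h, sub_self, sub_self]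
  rw [Finset.sum_eq_zero_iff_of_nonneg
    fun i _ => sub_nonneg.2 (sub_le_mul_log_div (hs i) (ht i))] at h1
  exact eq_of_mul_log_div_eq (hs i) (ht i) (sub_eq_zero.1 (h1 i (Finset.mem_univ i)))

/-- The cross entropy `∑ a_i b_j log x_{ij}`, which increases along the procedure. -/
def crossEntropy (a : Fin (R + 1) → ℝ) (b : Fin (S + 1) → ℝ)
    (x : Matrix (Fin (R + 1)) (Fin (S + 1)) ℝ) : ℝ :=
  ∑ i, ∑ j, a i * b j * Real.log (x i j)

/-- The gain is the relative entropy of `a` with respect to the current row sums. It is nonnegative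
when the total masses agree, and vanishes only when the row margins are already right. -/
lemma crossEntropy_rowScale (ha : ∀ i, 0 < a i) (hb1 : ∑ j, b j = 1) (hx : ∀ i j, 0 < x i j) :
    crossEntropy a b (rowScale a x) =
      crossEntropy a b x + ∑ i, a i * Real.log (a i / ∑ j, x i j) := by
  have : ∀ i j, a i * b j * Real.log (rowScale a x i j) =
      a i * b j * Real.log (x i j) + b j * (a i * Real.log (a i / ∑ j, x i j)) := by
    intro i j
    rw [rowScale_apply, mul_one, Real.log_mul (div_pos (ha i) (rowSum_pos hx i)).ne' (hx i j).ne']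
    ring
  simp_rw [crossEntropy, this, Finset.sum_add_distrib, ← Finset.sum_mul, hb1, one_mul]

lemma crossEntropy_colScale (hb : ∀ j, 0 < b j) (ha1 : ∑ i, a i = 1) (hx : ∀ i j, 0 < x i j) :
    crossEntropy a b (colScale b x) =
      crossEntropy a b x + ∑ j, b j * Real.log (b j / ∑ i, x i j) := by
  have : ∀ i j, a i * b j * Real.log (colScale b x i j) =
      a i * b j * Real.log (x i j) + a i * (b j * Real.log (b j / ∑ i, x i j)) := by
    intro i j
    rw [colScale_apply, one_mul, Real.log_mul (div_pos (hb j) (colSum_pos hx j)).ne' (hx i j).ne']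
    ring
  simp_rw [crossEntropy, this, Finset.sum_add_distrib, ← Finset.mul_sum, ← Finset.sum_mul, ha1,
    one_mul]

lemma entry_le_one (hx : ∀ i j, 0 < x i j) (h : ∑ i, ∑ j, x i j = 1) (i j) : x i j ≤ 1 := by
  rw [← h]
  exact (Finset.single_le_sum (f := x i) (fun j _ => (hx i j).le) (Finset.mem_univ j)).trans
    (Finset.single_le_sum (f := fun i => ∑ j, x i j) (fun i _ => (rowSum_pos hx i).le)
      (Finset.mem_univ i))

/-- Entries at most one make every term nonpositive, so each single term dominates the whole sum. A
lower bound on the cross entropy thus keeps all entries away from zero, which gives compactness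
inside the positive matrices. -/
lemma exp_crossEntropy_div_le (ha : ∀ i, 0 < a i) (hb : ∀ j, 0 < b j) (hx : ∀ i j, 0 < x i j)
    (h : ∑ i, ∑ j, x i j = 1) {c : ℝ} (hc : c ≤ crossEntropy a b x) (i j) :
    Real.exp (c / (a i * b j)) ≤ x i j := by
  have hab := mul_pos (ha i) (hb j)
  have hnp : ∀ i j, a i * b j * Real.log (x i j) ≤ 0 := fun i j =>
    mul_nonpos_of_nonneg_of_nonpos (mul_pos (ha i) (hb j)).le
      (Real.log_nonpos (hx i j).le (entry_le_one hx h i j))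
  rw [← Real.le_log_iff_exp_le (hx i j), div_le_iff₀' hab]
  have h1 : crossEntropy a b x ≤ ∑ j, a i * b j * Real.log (x i j) := by
    have := Finset.single_le_sum (f := fun i => -∑ j, a i * b j * Real.log (x i j))
      (fun i _ => neg_nonneg.2 (Finset.sum_nonpos fun j _ => hnp i j)) (Finset.mem_univ i)
    rw [Finset.sum_neg_distrib] at this
    exact neg_le_neg_iff.1 this
  have h2 : ∑ j, a i * b j * Real.log (x i j) ≤ a i * b j * Real.log (x i j) := by
    have := Finset.single_le_sum (f := fun j => -(a i * b j * Real.log (x i j)))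
      (fun j _ => neg_nonneg.2 (hnp i j)) (Finset.mem_univ j)
    rw [Finset.sum_neg_distrib] at this
    exact neg_le_neg_iff.1 this
  exact hc.trans (h1.trans h2)

/-- Every subsequence of the sequence of even steps accumulates at a strictly positive matrix
with the target margins and the initial odds ratios. -/
lemma exists_subseq_iterate (ha : ∀ i, 0 < a i) (hb : ∀ j, 0 < b j) (ha1 : ∑ i, a i = 1)
    (hb1 : ∑ j, b j = 1) (hx : ∀ i j, 0 < x i j) (ns : ℕ → ℕ) (hns : Tendsto ns atTop atTop) :
    ∃ y : Matrix (Fin (R + 1)) (Fin (S + 1)) ℝ, (∀ i j, 0 < y i j) ∧ margin₁ y = a ∧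
      margin₂ y = b ∧ logOdds y = logOdds x ∧ ∃ ms : ℕ → ℕ,
        Tendsto (fun n => (colScale b ∘ rowScale a)^[ns (ms n) + 1] x) atTop (𝓝 y) := by
  -- The shift by one ensures that a column scaling has been performed, so the column margins are
  -- exactly `b` and the total mass is one.
  set f : ℕ → Matrix (Fin (R + 1)) (Fin (S + 1)) ℝ :=
    fun N => (colScale b ∘ rowScale a)^[N + 1] x with hf
  have hfpos : ∀ N i j, 0 < f N i j := fun N => iterate_pos ha hb hx _
  have hfodds : ∀ N, logOdds (f N) = logOdds x := fun N => logOdds_iterate ha hb hx _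
  have hfsucc : ∀ N, f (N + 1) = colScale b (rowScale a (f N)) := fun N => by
    simp only [hf]
    rw [Function.iterate_succ_apply', Function.comp_apply]
  have hfcol : ∀ N j, ∑ i, f N i j = b j := fun N j => by
    simp only [hf]
    rw [Function.iterate_succ_apply', Function.comp_apply]
    exact colScale_colSum (rowScale_pos ha (iterate_pos ha hb hx _)) j
  have hftot : ∀ N, ∑ i, ∑ j, f N i j = 1 := fun N => by
    refine Finset.sum_comm.trans ?_
    simp_rw [hfcol, hb1]
  set D : Matrix (Fin (R + 1)) (Fin (S + 1)) ℝ → ℝ :=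
    fun z => ∑ i, a i * Real.log (a i / ∑ j, z i j) with hD
  have hD0 : ∀ N, 0 ≤ D (f N) := fun N =>
    sum_mul_log_div_nonneg ha (rowSum_pos (hfpos N)) (by rw [hftot, ha1])
  have hstep : ∀ N, D (f N) ≤ crossEntropy a b (f (N + 1)) - crossEntropy a b (f N) := by
    intro N
    have hRpos := rowScale_pos ha (hfpos N)
    have h1 : 0 ≤ ∑ j, b j * Real.log (b j / ∑ i, rowScale a (f N) i j) := by
      refine sum_mul_log_div_nonneg hb (colSum_pos hRpos) ?_
      rw [Finset.sum_comm]
      simp_rw [rowScale_rowSum (hfpos N), ha1, hb1]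
    rw [hfsucc, crossEntropy_colScale hb ha1 hRpos, crossEntropy_rowScale ha hb1 (hfpos N)]
    linarith
  have hmono : Monotone fun N => crossEntropy a b (f N) :=
    monotone_nat_of_le_succ fun N => by linarith [hD0 N, hstep N]
  have hbdd : BddAbove (Set.range fun N => crossEntropy a b (f N)) := by
    refine ⟨0, ?_⟩
    rintro _ ⟨N, rfl⟩
    exact Finset.sum_nonpos fun i _ => Finset.sum_nonpos fun j _ =>
      mul_nonpos_of_nonneg_of_nonpos (mul_pos (ha i) (hb j)).le
        (Real.log_nonpos (hfpos N i j).le (entry_le_one (hfpos N) (hftot N) i j))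
  -- The row divergence is bounded by the increments of a bounded monotone sequence, which tend to
  -- zero.
  have hDlim : Tendsto (fun N => D (f N)) atTop (𝓝 0) := by
    have hlim := tendsto_atTop_ciSup hmono hbdd
    have hdiff := (hlim.comp (tendsto_add_atTop_nat 1)).sub hlim
    rw [sub_self] at hdiff
    exact squeeze_zero hD0 hstep hdiff
  set c := crossEntropy a b (f 0)
  let K : Set (Fin (R + 1) → Fin (S + 1) → ℝ) :=
    Set.univ.pi fun i => Set.univ.pi fun j => Set.Icc (Real.exp (c / (a i * b j))) 1
  have hK : IsCompact K := isCompact_univ_pi fun i => isCompact_univ_pi fun j => isCompact_Icc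
  have hfK : ∀ N, f N ∈ K := fun N i _ j _ =>
    ⟨exp_crossEntropy_div_le ha hb (hfpos N) (hftot N) (hmono (Nat.zero_le N)) i j,
      entry_le_one (hfpos N) (hftot N) i j⟩
  obtain ⟨y, hyK, ms, hms, hlim⟩ := IsCompact.tendsto_subseq
    (X := Fin (R + 1) → Fin (S + 1) → ℝ) hK (x := fun n => f (ns n)) fun n => hfK _
  have hypos : ∀ i j, 0 < y i j := fun i j =>
    (Real.exp_pos _).trans_le (hyK i (Set.mem_univ i) j (Set.mem_univ j)).1
  have hent : ∀ i j, Tendsto (fun n => f (ns (ms n)) i j) atTop (𝓝 (y i j)) := fun i j =>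
    (tendsto_pi_nhds.1 ((tendsto_pi_nhds.1 hlim) i)) j
  have hycol : ∀ j, ∑ i, y i j = b j := fun j => by
    have h1 : Tendsto (fun n => ∑ i, f (ns (ms n)) i j) atTop (𝓝 (∑ i, y i j)) :=
      tendsto_finsetSum _ fun i _ => hent i j
    simp_rw [hfcol] at h1
    exact tendsto_nhds_unique h1 tendsto_const_nhds |>.trans rfl
  have hyD : D y = 0 := by
    have h1 : Tendsto (fun n => D (f (ns (ms n)))) atTop (𝓝 (D y)) := by
      refine tendsto_finsetSum _ fun i _ => Tendsto.const_mul _ ?_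
      have hrow : Tendsto (fun n => ∑ j, f (ns (ms n)) i j) atTop (𝓝 (∑ j, y i j)) :=
        tendsto_finsetSum _ fun j _ => hent i j
      exact (tendsto_const_nhds.div hrow (rowSum_pos hypos i).ne').log
        (div_pos (ha i) (rowSum_pos hypos i)).ne'
    exact tendsto_nhds_unique h1 (hDlim.comp (hns.comp hms.tendsto_atTop))
  -- Zero divergence at the limit point is the equality case of Gibbs' inequality.
  have hyrow : ∀ i, a i = ∑ j, y i j := by
    refine eq_of_sum_mul_log_div_eq_zero ha (rowSum_pos hypos) ?_ hyD
    rw [Finset.sum_comm]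
    simp_rw [hycol, ha1, hb1]
  refine ⟨y, hypos, funext fun i => (hyrow i).symm, funext hycol, ?_, ms, hlim⟩
  have h1 := (continuousAt_logOdds (x := y) hypos).tendsto.comp hlim
  exact tendsto_nhds_unique h1 (tendsto_const_nhds.congr fun n => (hfodds _).symm)

lemma rowScale_eq_self (hx : ∀ i j, 0 < x i j) (h : margin₁ x = a) : rowScale a x = x := by
  ext i j
  rw [rowScale_apply, ← h, margin₁, div_self (rowSum_pos hx i).ne', one_mul, one_mul]

lemma continuousAt_rowScale (a : Fin (R + 1) → ℝ) (hx : ∀ i j, 0 < x i j) :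
    ContinuousAt (rowScale a) x := by
  refine continuousAt_pi.2 fun i => continuousAt_pi.2 fun j => ?_
  refine ContinuousAt.div ?_ ?_ (rowSum_pos hx i).ne'
  · exact (continuous_const.mul (continuous_id.matrix_elem i j)).continuousAt
  · exact (continuous_finsetSum _ fun j _ => continuous_id.matrix_elem i j).continuousAt

/-- The iterative proportional fitting procedure converges from any strictly positive matrix, to
the strictly positive matrix with the target margins and the initial odds ratios. -/
theorem exists_ipfpTendsto (ha : ∀ i, 0 < a i) (hb : ∀ j, 0 < b j) (ha1 : ∑ i, a i = 1)
    (hb1 : ∑ j, b j = 1) (hx : ∀ i j, 0 < x i j) :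
    ∃ y : Matrix (Fin (R + 1)) (Fin (S + 1)) ℝ, (∀ i j, 0 < y i j) ∧ margin₁ y = a ∧
      margin₂ y = b ∧ logOdds y = logOdds x ∧ IPFPTendsto a b x y := by
  obtain ⟨y, hy, hy1, hy2, hyo, -⟩ := exists_subseq_iterate ha hb ha1 hb1 hx id tendsto_id
  refine ⟨y, hy, hy1, hy2, hyo, ?_⟩
  have heven' : Tendsto (fun N => (colScale b ∘ rowScale a)^[N + 1] x) atTop (𝓝 y) := by
    -- All accumulation points share margins and odds ratios, hence coincide; every subsequence then
    -- has a further subsequence converging to `y`.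
    refine tendsto_of_subseq_tendsto fun ns hns => ?_
    obtain ⟨z, hz, hz1, hz2, hzo, ms, hms⟩ := exists_subseq_iterate ha hb ha1 hb1 hx ns hns
    obtain rfl : z = y := eq_of_logOdds_eq hz hy (hz1.trans hy1.symm) (hz2.trans hy2.symm)
      (hzo.trans hyo.symm)
    exact ⟨ms, hms⟩
  have heven : Tendsto (fun N => (colScale b ∘ rowScale a)^[N] x) atTop (𝓝 y) :=
    (tendsto_add_atTop_iff_nat (f := fun N => (colScale b ∘ rowScale a)^[N] x) 1).1 heven'
  -- Row scaling is continuous at `y` and fixes it, so the odd steps have the same limit.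
  have hodd : Tendsto (fun N => rowScale a ((colScale b ∘ rowScale a)^[N] x)) atTop (𝓝 y) := by
    have := (continuousAt_rowScale a hy).tendsto.comp heven
    rwa [rowScale_eq_self hy hy1] at this
  have hhalf : Tendsto (fun n : ℕ => n / 2) atTop atTop :=
    tendsto_atTop.2 fun N => (eventually_ge_atTop (2 * N)).mono fun n hn => by omega
  exact Tendsto.if' (heven.comp hhalf) (hodd.comp hhalf)

end Scaling

/-! ### Uniform target margins and the characterization of `toCopula` -/

lemma unif_pos (n : ℕ) (i : Fin (n + 1)) : 0 < unif n i := by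
  unfold unif
  positivity

lemma sum_unif (n : ℕ) : ∑ i, unif n i = 1 := by
  simp only [unif, Finset.sum_const, Finset.card_univ, Fintype.card_fin, nsmul_eq_mul]
  push_cast
  field_simp

lemma toCopula_spec {x : Matrix (Fin (R + 1)) (Fin (S + 1)) ℝ} (hx : ∀ i j, 0 < x i j) :
    (∀ i j, 0 < toCopula x i j) ∧ margin₁ (toCopula x) = unif R ∧
      margin₂ (toCopula x) = unif S ∧ logOdds (toCopula x) = logOdds x := by
  obtain ⟨y, hy, hy1, hy2, hyo, hlim⟩ :=
    exists_ipfpTendsto (unif_pos R) (unif_pos S) (sum_unif R) (sum_unif S) hx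
  -- `limUnder` has a meaningful value here only because convergence has just been established.
  have : toCopula x = y := Tendsto.limUnder_eq hlim
  rw [this]
  exact ⟨hy, hy1, hy2, hyo⟩

/-- `toCopula x` is the only strictly positive copula p.m.f. with the odds ratios of `x`. -/
lemma toCopula_eq {x y : Matrix (Fin (R + 1)) (Fin (S + 1)) ℝ} (hx : ∀ i j, 0 < x i j)
    (hy : ∀ i j, 0 < y i j) (hy1 : margin₁ y = unif R) (hy2 : margin₂ y = unif S)
    (hyo : logOdds y = logOdds x) : toCopula x = y := by
  obtain ⟨h0, h1, h2, ho⟩ := toCopula_spec hx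
  exact eq_of_logOdds_eq h0 hy (h1.trans hy1.symm) (h2.trans hy2.symm) (ho.trans hyo.symm)

/-! ### The matrices `K`, `L_u` and `M_p` -/

@[simp] lemma Hmat_last (R : ℕ) (k : Fin R) : Hmat R (Fin.last R) k = -1 := by simp [Hmat]

@[simp] lemma Hmat_castSucc (R : ℕ) (i k : Fin R) :
    Hmat R i.castSucc k = if i = k then 1 else 0 := by
  simp [Hmat, (Fin.castSucc_lt_last i).ne]

lemma sum_Hmat (R : ℕ) (k : Fin R) : ∑ i, Hmat R i k = 0 := by
  simp [Fin.sum_univ_castSucc]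

/-- `K` is the Kronecker product of the two matrices `H`; this form drives all computations with it.
-/
lemma Kmat_apply (q : Fin (S + 1) × Fin (R + 1)) (c : Fin S × Fin R) :
    Kmat R S q c = Hmat S q.1 c.1 * Hmat R q.2 c.2 := by
  obtain ⟨j, i⟩ := q
  refine Fin.lastCases ?_ (fun j => ?_) j
  · simp [Kmat]
  · by_cases h : j = c.1 <;> simp [Kmat, (Fin.castSucc_lt_last j).ne, h]

/-- Applied to a vector of logarithms, these alternating sums are the log odds ratios. -/
lemma Kmat_transpose_mulVec (y : Fin (S + 1) × Fin (R + 1) → ℝ) (c : Fin S × Fin R) :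
    ((Kmat R S).transpose.mulVec y) c = y (c.1.castSucc, c.2.castSucc)
      + y (Fin.last S, Fin.last R) - y (Fin.last S, c.2.castSucc)
      - y (c.1.castSucc, Fin.last R) := by
  simp [Matrix.mulVec, dotProduct, Kmat_apply, Fintype.sum_prod_type, Fin.sum_univ_castSucc,
    Finset.sum_add_distrib]
  ring

lemma Kmat_mulVec_castSucc (z : Fin S × Fin R → ℝ) (l : Fin S) (k : Fin R) :
    ((Kmat R S).mulVec z) (l.castSucc, k.castSucc) = z (l, k) := by
  simp [Matrix.mulVec, dotProduct, Kmat_apply, Fintype.sum_prod_type]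

lemma Kmat_mulVec_injective : Function.Injective (Kmat R S).mulVec := by
  intro z z' h
  ext ⟨l, k⟩
  rw [← Kmat_mulVec_castSucc z, ← Kmat_mulVec_castSucc z', h]

/-- The columns of `H` sum to zero, so adding `K z` does not change the margins of a matrix. -/
lemma sum_snd_Kmat_mulVec (z : Fin S × Fin R → ℝ) (j : Fin (S + 1)) :
    ∑ i, ((Kmat R S).mulVec z) (j, i) = 0 := by
  simp_rw [Matrix.mulVec, dotProduct, Kmat_apply]
  rw [Finset.sum_comm]
  simp_rw [← Finset.sum_mul, ← Finset.mul_sum, sum_Hmat]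
  simp

lemma sum_fst_Kmat_mulVec (z : Fin S × Fin R → ℝ) (i : Fin (R + 1)) :
    ∑ j, ((Kmat R S).mulVec z) (j, i) = 0 := by
  simp_rw [Matrix.mulVec, dotProduct, Kmat_apply]
  rw [Finset.sum_comm]
  simp_rw [← Finset.sum_mul, sum_Hmat]
  simp

/-- For a copula p.m.f., `L_u = Kᵀ diag(1 / vec u) K`. -/
lemma Lmat_eq {u : Matrix (Fin (R + 1)) (Fin (S + 1)) ℝ} (hu : IsCopulaPMF u) :
    Lmat u = (Kmat R S).transpose * Matrix.diagonal (fun q => (Matrix.vec u q)⁻¹) * Kmat R S := by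
  -- Uniform margins identify the denominators in `L_u` with the entries of `u` in the last row, the
  -- last column and the corner.
  have hcol : ∀ j, 1 / ((S : ℝ) + 1) - ∑ g : Fin R, u g.castSucc j = u (Fin.last R) j := fun j => by
    have := congrFun hu.margin₂_eq j
    rw [margin₂, unif, Fin.sum_univ_castSucc] at this
    linarith
  have hrow : ∀ i, 1 / ((R : ℝ) + 1) - ∑ h : Fin S, u i h.castSucc = u i (Fin.last S) := fun i => by
    have := congrFun hu.margin₁_eq i
    rw [margin₁, unif, Fin.sum_univ_castSucc] at this
    linarith
  have hlast : 1 / ((R : ℝ) + 1) + 1 / ((S : ℝ) + 1) - 1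
      + ∑ g : Fin R, ∑ h : Fin S, u g.castSucc h.castSucc = u (Fin.last R) (Fin.last S) := by
    have h1 : ∀ g : Fin R, ∑ h : Fin S, u g.castSucc h.castSucc =
        1 / ((R : ℝ) + 1) - u g.castSucc (Fin.last S) := fun g => by linarith [hrow g.castSucc]
    simp_rw [h1, Finset.sum_sub_distrib]
    have h2 : ∑ g : Fin R, 1 / ((R : ℝ) + 1) = 1 - 1 / ((R : ℝ) + 1) := by
      simp
      field_simp
      ring
    linarith [hcol (Fin.last S)]
  ext ⟨l, k⟩ ⟨j, i⟩
  have h3 : ((Kmat R S).transpose * Matrix.diagonal (fun q => (Matrix.vec u q)⁻¹) * Kmat R S)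
      (l, k) (j, i) = ((Kmat R S).transpose.mulVec
        fun q => (Matrix.vec u q)⁻¹ * Kmat R S q (j, i)) (l, k) := by
    rw [Matrix.mul_assoc, Matrix.mul_apply]
    simp [Matrix.mulVec, dotProduct, Matrix.diagonal_mul]
  rw [h3, Kmat_transpose_mulVec]
  simp only [Kmat_apply, Hmat_castSucc, Hmat_last, Matrix.vec, Lmat, Matrix.of_apply, hcol, hrow,
    hlast, @eq_comm _ i k, @eq_comm _ j l, ite_and]
  split_ifs <;> ring

/-- `Kᵀ diag(1/u) K` is a positive definite form restricted along the injective map `K`, hence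
positive definite. -/
lemma isUnit_Lmat {u : Matrix (Fin (R + 1)) (Fin (S + 1)) ℝ} (hu : IsCopulaPMF u)
    (hpos : ∀ i j, 0 < u i j) : IsUnit (Lmat u) := by
  rw [Lmat_eq hu]
  have hd : (Matrix.diagonal (fun q => (Matrix.vec u q)⁻¹)).PosDef :=
    Matrix.PosDef.diagonal fun q => inv_pos.2 (hpos _ _)
  exact (hd.conjTranspose_mul_mul_same Kmat_mulVec_injective).isUnit

/-- On vectors whose entries sum to zero, `M_p N` is `-Kᵀ diag(1 / vec p)`. -/
lemma Mmat_mul_Nmat_mulVec {p : Matrix (Fin (R + 1)) (Fin (S + 1)) ℝ}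
    (hp : ∑ q, Matrix.vec p q = 1) {h : Fin (S + 1) × Fin (R + 1) → ℝ} (hh : ∑ q, h q = 0) :
    (Mmat p * Nmat R S).mulVec h =
      -(Kmat R S).transpose.mulVec fun q => (Matrix.vec p q)⁻¹ * h q := by
  have hsub : ∀ f : Fin (S + 1) × Fin (R + 1) → ℝ,
      ∑ q : ButLast R S, f q.1 = ∑ q, f q - f (Fin.last S, Fin.last R) := fun f => by
    rw [← Finset.sum_subtype (Finset.univ.erase (Fin.last S, Fin.last R)) (by simp) f,
      Finset.sum_erase_eq_sub (Finset.mem_univ _)]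
  have hN : (Nmat R S).mulVec h = fun b => h b.1 := by
    ext b
    simp [Nmat, Matrix.mulVec, dotProduct]
  have hplast : 1 - ∑ q : ButLast R S, p q.1.2 q.1.1 = p (Fin.last R) (Fin.last S) := by
    rw [hsub fun q => p q.2 q.1]
    have : ∑ q : Fin (S + 1) × Fin (R + 1), p q.2 q.1 = 1 := hp
    linarith
  rw [← Matrix.mulVec_mulVec, hN]
  ext ⟨l, k⟩
  rw [Pi.neg_apply, Kmat_transpose_mulVec, Matrix.mulVec, dotProduct]
  -- Extends the row of `M_p`, multiplied by `h`, to all cells. Since `h` has total zero, the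
  -- constant `1 / p_{rs}` contributes only minus its value at the deleted cell, which is the
  -- missing corner term.
  let f : Fin (S + 1) × Fin (R + 1) → ℝ := fun q =>
    -(if q = (l.castSucc, k.castSucc) then (p k.castSucc l.castSucc)⁻¹ * h q else 0)
    + (if q = (l.castSucc, Fin.last R) then (p (Fin.last R) l.castSucc)⁻¹ * h q else 0)
    + (if q = (Fin.last S, k.castSucc) then (p k.castSucc (Fin.last S))⁻¹ * h q else 0)
    + (p (Fin.last R) (Fin.last S))⁻¹ * h q
  have hM : ∀ b : ButLast R S, Mmat p (l, k) b * h b.1 = f b.1 := by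
    rintro ⟨⟨j, i⟩, hq⟩
    simp only [f, Mmat, Matrix.of_apply, hplast, Prod.mk.injEq, @and_comm (j = _)]
    split_ifs <;> ring
  refine (Finset.sum_congr rfl fun b _ => hM b).trans ((hsub f).trans ?_)
  simp only [f, Finset.sum_add_distrib, Finset.sum_neg_distrib, Finset.sum_ite_eq', Finset.mem_univ,
    if_true, ← Finset.mul_sum, hh, Prod.mk.injEq, (Fin.castSucc_lt_last _).ne', and_false,
    false_and, if_false, Matrix.vec]
  ring

/-! ### The derivative of `toCopula` -/

/-- The matrix with given column-major vectorization. -/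
def unvec (w : Fin (S + 1) × Fin (R + 1) → ℝ) : Matrix (Fin (R + 1)) (Fin (S + 1)) ℝ :=
  Matrix.of fun i j => w (j, i)

@[simp] lemma vec_unvec (w : Fin (S + 1) × Fin (R + 1) → ℝ) : Matrix.vec (unvec w) = w := rfl

/-- The continuous linear map given by multiplication with a matrix. -/
def mulVecCLM {ι κ : Type*} [Fintype ι] [Fintype κ] (A : Matrix ι κ ℝ) : (κ → ℝ) →L[ℝ] (ι → ℝ) :=
  LinearMap.toContinuousLinearMap A.mulVecLin

@[simp] lemma mulVecCLM_apply {ι κ : Type*} [Fintype ι] [Fintype κ] (A : Matrix ι κ ℝ)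
    (v : κ → ℝ) : mulVecCLM A v = A.mulVec v := rfl

/-- The entrywise logarithm. -/
def logVec {ι : Type*} (w : ι → ℝ) : ι → ℝ := fun q => Real.log (w q)

lemma hasStrictFDerivAt_logVec {ι : Type*} [Fintype ι] [DecidableEq ι] {w : ι → ℝ}
    (hw : ∀ q, w q ≠ 0) :
    HasStrictFDerivAt logVec (mulVecCLM (Matrix.diagonal fun q => (w q)⁻¹)) w := by
  refine hasStrictFDerivAt_pi'.2 fun q => ?_
  have h1 := (ContinuousLinearMap.proj (R := ℝ) (φ := fun _ : ι => ℝ) q).hasStrictFDerivAt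
    (x := w)
  refine (h1.log (hw q)).congr_fderiv ?_
  ext v
  simp [Matrix.mulVec_diagonal]

lemma logOdds_eq_of_transpose_mulVec_eq {x y : Matrix (Fin (R + 1)) (Fin (S + 1)) ℝ}
    (h : (Kmat R S).transpose.mulVec (logVec (Matrix.vec x)) =
      (Kmat R S).transpose.mulVec (logVec (Matrix.vec y))) : logOdds x = logOdds y := by
  ext i j
  refine Fin.lastCases ?_ (fun k => ?_) i
  · simp [logOdds]
  refine Fin.lastCases ?_ (fun l => ?_) j
  · simp [logOdds]
  have := congrFun h (l, k)
  simpa only [Kmat_transpose_mulVec, logVec, Matrix.vec, logOdds, Matrix.of_apply] using this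

lemma transpose_mulVec_eq_of_logOdds_eq {x y : Matrix (Fin (R + 1)) (Fin (S + 1)) ℝ}
    (h : logOdds x = logOdds y) : (Kmat R S).transpose.mulVec (logVec (Matrix.vec x)) =
      (Kmat R S).transpose.mulVec (logVec (Matrix.vec y)) := by
  ext ⟨l, k⟩
  have := congrFun (congrFun h k.castSucc) l.castSucc
  simpa only [Kmat_transpose_mulVec, logVec, Matrix.vec, logOdds, Matrix.of_apply] using this

/-- The map `toCopula` has derivative `J_{u,p}` at `p` along the matrices of total mass one. -/
theorem toCopula_sub_isLittleO {u p : Matrix (Fin (R + 1)) (Fin (S + 1)) ℝ} (hu : IsCopulaPMF u)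
    (hupos : ∀ i j, 0 < u i j) (hp : ∀ i j, 0 < p i j) (hp1 : ∑ q, Matrix.vec p q = 1)
    (hodds : logOdds u = logOdds p) :
    (fun x => Matrix.vec (toCopula (unvec x)) - Matrix.vec u
        - (Jmat u p).mulVec (x - Matrix.vec p))
      =o[𝓝[{x | ∑ q, x q = 1}] (Matrix.vec p)] fun x => x - Matrix.vec p := by
  set K := Kmat R S with hK
  set L := Lmat u with hL
  have hLunit : IsUnit L := isUnit_Lmat hu hupos
  have hLdet : IsUnit L.det := (Matrix.isUnit_iff_isUnit_det _).1 hLunit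
  -- Log odds ratios in the affine chart of matrices with the margins of `u`; the chain rule gives
  -- derivative `Kᵀ diag(1/u) K = L_u` at zero.
  let G : (Fin S × Fin R → ℝ) → (Fin S × Fin R → ℝ) := fun z =>
    mulVecCLM K.transpose (logVec (Matrix.vec u + mulVecCLM K z))
  let L' : (Fin S × Fin R → ℝ) ≃L[ℝ] (Fin S × Fin R → ℝ) :=
    ContinuousLinearEquiv.equivOfInverse (mulVecCLM L) (mulVecCLM L⁻¹)
      (fun v => by simp [Matrix.mulVec_mulVec, Matrix.nonsing_inv_mul _ hLdet])
      (fun v => by simp [Matrix.mulVec_mulVec, Matrix.mul_nonsing_inv _ hLdet])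
  have hG : HasStrictFDerivAt G (L' : (Fin S × Fin R → ℝ) →L[ℝ] (Fin S × Fin R → ℝ)) 0 := by
    have h1 : HasStrictFDerivAt (fun z => Matrix.vec u + mulVecCLM K z) (mulVecCLM K) 0 :=
      (mulVecCLM K).hasStrictFDerivAt.const_add _
    have hval : Matrix.vec u + mulVecCLM K 0 = Matrix.vec u := by simp
    have h2 := hasStrictFDerivAt_logVec (w := Matrix.vec u + mulVecCLM K 0)
      (by rw [hval]; exact fun q => (hupos _ _).ne')
    refine (((mulVecCLM K.transpose).hasStrictFDerivAt).comp 0 (h2.comp 0 h1)).congr_fderiv ?_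
    ext1 v
    have : (L' : (Fin S × Fin R → ℝ) →L[ℝ] (Fin S × Fin R → ℝ)) v = L.mulVec v := rfl
    rw [this, hL, Lmat_eq hu]
    simp [Matrix.mulVec_mulVec, Matrix.mul_assoc, hK]
  let g := hG.localInverse G L' 0
  have hG0 : G 0 = mulVecCLM K.transpose (logVec (Matrix.vec p)) := by
    simp only [G, mulVecCLM_apply, Matrix.mulVec_zero, add_zero, hK]
    exact transpose_mulVec_eq_of_logOdds_eq hodds
  have hg0 : g (G 0) = 0 := hG.localInverse_apply_image
  have hgd : HasFDerivAt g (mulVecCLM L⁻¹) (G 0) := hG.to_localInverse.hasFDerivAt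
  have hlogp : HasFDerivAt (logVec : (Fin (S + 1) × Fin (R + 1) → ℝ) → _)
      (mulVecCLM (Matrix.diagonal fun q => (Matrix.vec p q)⁻¹)) (Matrix.vec p) :=
    (hasStrictFDerivAt_logVec fun q => (hp _ _).ne').hasFDerivAt
  have hinner : HasFDerivAt (fun x => mulVecCLM K.transpose (logVec x)) _ (Matrix.vec p) :=
    (mulVecCLM K.transpose).hasFDerivAt.comp _ hlogp
  rw [hG0] at hgd
  have hcomp : HasFDerivAt (fun x => g (mulVecCLM K.transpose (logVec x))) _ (Matrix.vec p) :=
    HasFDerivAt.comp (f := fun x => mulVecCLM K.transpose (logVec x)) (Matrix.vec p) hgd hinner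
  have hΨ : HasFDerivAt (fun x => mulVecCLM K (g (mulVecCLM K.transpose (logVec x)))) _
      (Matrix.vec p) :=
    (mulVecCLM K).hasFDerivAt.comp _ hcomp
  have hΨ0 : mulVecCLM K (g (mulVecCLM K.transpose (logVec (Matrix.vec p)))) = 0 := by
    rw [← hG0, hg0, map_zero]
  have hev1 : ∀ᶠ x in 𝓝 (Matrix.vec p),
      G (g (mulVecCLM K.transpose (logVec x))) = mulVecCLM K.transpose (logVec x) := by
    have := hG.eventually_right_inverse
    rw [hG0] at this
    exact hinner.continuousAt.eventually this
  have hev2 : ∀ᶠ x in 𝓝 (Matrix.vec p), ∀ q, 0 < x q :=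
    eventually_all.2 fun q => (continuous_apply q).continuousAt.eventually_const_lt (hp _ _)
  -- The candidate equals `u` at `p`, so by continuity it stays positive nearby, as uniqueness
  -- requires.
  have hev3 : ∀ᶠ x in 𝓝 (Matrix.vec p), ∀ q,
      0 < (Matrix.vec u + mulVecCLM K (g (mulVecCLM K.transpose (logVec x)))) q := by
    refine eventually_all.2 fun q => ?_
    have hc : ContinuousAt (fun x =>
        (Matrix.vec u + mulVecCLM K (g (mulVecCLM K.transpose (logVec x)))) q) (Matrix.vec p) :=
      continuousAt_const.add ((continuous_apply q).continuousAt.comp hΨ.continuousAt)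
    refine hc.eventually_const_lt ?_
    change 0 < (Matrix.vec u + mulVecCLM K (g (mulVecCLM K.transpose (logVec (Matrix.vec p))))) q
    rw [hΨ0, add_zero]
    exact hupos _ _
  have hlittle := hΨ.isLittleO
  refine (hlittle.mono nhdsWithin_le_nhds).congr' ?_ EventuallyEq.rfl
  filter_upwards [nhdsWithin_le_nhds hev1, nhdsWithin_le_nhds hev2, nhdsWithin_le_nhds hev3,
    self_mem_nhdsWithin] with x h1 h2 h3 hx1
  -- The candidate has uniform margins because `K z` has zero margins, and the odds ratios of `x`
  -- because `g` is a right inverse of `G`.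
  have hU : toCopula (unvec x) =
      unvec (Matrix.vec u + mulVecCLM K (g (mulVecCLM K.transpose (logVec x)))) := by
    refine toCopula_eq (fun i j => h2 _) (fun i j => h3 _) ?_ ?_ ?_
    · ext i
      have := congrFun hu.margin₁_eq i
      simp only [margin₁, unvec, Matrix.of_apply, Pi.add_apply, Finset.sum_add_distrib,
        mulVecCLM_apply, hK, sum_fst_Kmat_mulVec, add_zero] at this ⊢
      exact this
    · ext j
      have := congrFun hu.margin₂_eq j
      simp only [margin₂, unvec, Matrix.of_apply, Pi.add_apply, Finset.sum_add_distrib,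
        mulVecCLM_apply, hK, sum_snd_Kmat_mulVec, add_zero] at this ⊢
      exact this
    · refine logOdds_eq_of_transpose_mulVec_eq ?_
      rw [vec_unvec, vec_unvec]
      exact h1
  -- This is where total mass one is needed: `M_p N` agrees with `-Kᵀ diag(1/p)` only on vectors of
  -- zero sum.
  have hsum0 : ∑ q, (x - Matrix.vec p) q = 0 := by
    simp only [Pi.sub_apply, Finset.sum_sub_distrib, hp1]
    exact sub_eq_zero.2 hx1
  have hJ : (Jmat u p).mulVec (x - Matrix.vec p) = K.mulVec (L⁻¹.mulVec (K.transpose.mulVec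
      ((Matrix.diagonal fun q => (Matrix.vec p q)⁻¹).mulVec (x - Matrix.vec p)))) := by
    rw [Jmat, Matrix.neg_mulVec, Matrix.mul_assoc, ← Matrix.mulVec_mulVec,
      Mmat_mul_Nmat_mulVec hp1 hsum0, Matrix.mulVec_neg, neg_neg, ← Matrix.mulVec_mulVec]
    congr 3
    ext q
    simp [Matrix.mulVec_diagonal]
  rw [hU, vec_unvec, hJ, hΨ0]
  simp

/-! ### Score and Hessian -/

lemma IsCopulaPMF.sum_vec {u : Matrix (Fin (R + 1)) (Fin (S + 1)) ℝ} (hu : IsCopulaPMF u) :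
    ∑ q, Matrix.vec u q = 1 := by
  rw [Fintype.sum_prod_type, ← sum_unif S, ← hu.margin₂_eq]
  rfl

section Family

variable {Θ : Set (EuclideanSpace ℝ (Fin m))}
  {u : EuclideanSpace ℝ (Fin m) → Matrix (Fin (R + 1)) (Fin (S + 1)) ℝ}

/-- Differentiability is assumed for the log-probabilities; that of the probabilities follows by
writing them as exponentials on the open set `Θ`. -/
lemma hasFDerivAt_pmf (hΘ : IsOpen Θ) (hupos : ∀ θ ∈ Θ, ∀ i j, 0 < u θ i j)
    (hdiff : ∀ i j, ∀ t ∈ Θ, DifferentiableAt ℝ (logProb u i j) t) (i : Fin (R + 1))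
    (j : Fin (S + 1)) {θ : EuclideanSpace ℝ (Fin m)} (hθ : θ ∈ Θ) :
    HasFDerivAt (fun t => u t i j) (u θ i j • fderiv ℝ (logProb u i j) θ) θ := by
  have h1 := (hdiff i j θ hθ).hasFDerivAt.exp
  have h2 : Real.exp (logProb u i j θ) = u θ i j := Real.exp_log (hupos θ hθ i j)
  rw [h2] at h1
  refine h1.congr_of_eventuallyEq ?_
  filter_upwards [hΘ.mem_nhds hθ] with t ht
  exact (Real.exp_log (hupos t ht i j)).symm

/-- The expected score vanishes. -/
lemma sum_smul_fderiv_logProb (hΘ : IsOpen Θ) (hu : ∀ θ ∈ Θ, IsCopulaPMF (u θ))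
    (hupos : ∀ θ ∈ Θ, ∀ i j, 0 < u θ i j)
    (hdiff : ∀ i j, ∀ t ∈ Θ, DifferentiableAt ℝ (logProb u i j) t)
    {θ : EuclideanSpace ℝ (Fin m)} (hθ : θ ∈ Θ) :
    ∑ q : Fin (S + 1) × Fin (R + 1), u θ q.2 q.1 • fderiv ℝ (logProb u q.2 q.1) θ = 0 := by
  have h1 : HasFDerivAt (fun t => ∑ q : Fin (S + 1) × Fin (R + 1), u t q.2 q.1)
      (∑ q : Fin (S + 1) × Fin (R + 1), u θ q.2 q.1 • fderiv ℝ (logProb u q.2 q.1) θ) θ :=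
    HasFDerivAt.fun_sum fun q _ => hasFDerivAt_pmf hΘ hupos hdiff q.2 q.1 hθ
  have h2 : HasFDerivAt (fun t => ∑ q : Fin (S + 1) × Fin (R + 1), u t q.2 q.1)
      (0 : EuclideanSpace ℝ (Fin m) →L[ℝ] ℝ) θ := by
    refine (hasFDerivAt_const (1 : ℝ) θ).congr_of_eventuallyEq ?_
    filter_upwards [hΘ.mem_nhds hθ] with t ht
    exact (hu t ht).sum_vec
  exact h1.unique h2

/-- The information identity, as an identity of bilinear forms. -/
lemma sum_fderiv_fderiv_logProb (hΘ : IsOpen Θ) (hu : ∀ θ ∈ Θ, IsCopulaPMF (u θ))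
    (hupos : ∀ θ ∈ Θ, ∀ i j, 0 < u θ i j)
    (hdiff : ∀ i j, ∀ t ∈ Θ, DifferentiableAt ℝ (logProb u i j) t ∧
      DifferentiableAt ℝ (fderiv ℝ (logProb u i j)) t)
    {θ : EuclideanSpace ℝ (Fin m)} (hθ : θ ∈ Θ) (v w : EuclideanSpace ℝ (Fin m)) :
    ∑ q : Fin (S + 1) × Fin (R + 1),
        u θ q.2 q.1 * fderiv ℝ (fderiv ℝ (logProb u q.2 q.1)) θ v w =
      -∑ q : Fin (S + 1) × Fin (R + 1), u θ q.2 q.1 *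
        (fderiv ℝ (logProb u q.2 q.1) θ v * fderiv ℝ (logProb u q.2 q.1) θ w) := by
  have hd1 := fun i j t ht => (hdiff i j t ht).1
  have h1 := HasFDerivAt.fun_sum (u := Finset.univ)
    fun (q : Fin (S + 1) × Fin (R + 1)) _ =>
      (hasFDerivAt_pmf hΘ hupos hd1 q.2 q.1 hθ).fun_smul (hdiff q.2 q.1 θ hθ).2.hasFDerivAt
  -- The expected score vanishes on a whole neighbourhood, so its derivative is zero; the product
  -- rule computes the same derivative as Hessian term plus squared-score term.
  have h2 : HasFDerivAt (fun t => ∑ q : Fin (S + 1) × Fin (R + 1),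
      u t q.2 q.1 • fderiv ℝ (logProb u q.2 q.1) t)
      (0 : EuclideanSpace ℝ (Fin m) →L[ℝ] EuclideanSpace ℝ (Fin m) →L[ℝ] ℝ) θ := by
    refine (hasFDerivAt_const (0 : EuclideanSpace ℝ (Fin m) →L[ℝ] ℝ) θ).congr_of_eventuallyEq ?_
    filter_upwards [hΘ.mem_nhds hθ] with t ht
    exact sum_smul_fderiv_logProb hΘ hu hupos hd1 ht
  have h3 := congrArg (fun A => A v w) (h1.unique h2)
  simp only [sum_apply, add_apply,
    smul_apply, ContinuousLinearMap.smulRight_apply, smul_eq_mul,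
    zero_apply, Finset.sum_add_distrib, mul_assoc] at h3
  linarith

lemma hessian_apply (i : Fin (R + 1)) (j : Fin (S + 1)) {θ : EuclideanSpace ℝ (Fin m)}
    (hdiff : DifferentiableAt ℝ (fderiv ℝ (logProb u i j)) θ) (k l : Fin m) :
    hessian u θ i j k l = fderiv ℝ (fderiv ℝ (logProb u i j)) θ (EuclideanSpace.single k 1)
      (EuclideanSpace.single l 1) := by
  have h := (hdiff.hasFDerivAt.clm_apply
    (hasFDerivAt_const (EuclideanSpace.single l (1 : ℝ)) θ)).fderiv
  have h2 : partialD l (logProb u i j) =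
      fun t => fderiv ℝ (logProb u i j) t (EuclideanSpace.single l 1) := rfl
  rw [hessian, Matrix.of_apply, partialD, h2, h]
  simp

lemma fisher_apply (θ : EuclideanSpace ℝ (Fin m)) (k l : Fin m) :
    fisher u θ k l = ∑ q : Fin (S + 1) × Fin (R + 1), u θ q.2 q.1 *
      (fderiv ℝ (logProb u q.2 q.1) θ (EuclideanSpace.single k 1)
        * fderiv ℝ (logProb u q.2 q.1) θ (EuclideanSpace.single l 1)) := by
  rw [Fintype.sum_prod_type_right]
  simp [fisher, Matrix.sum_apply, Matrix.vecMulVec_apply, score, partialD]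

/-- The information identity. -/
lemma expHessian_eq_neg_fisher (hΘ : IsOpen Θ) (hu : ∀ θ ∈ Θ, IsCopulaPMF (u θ))
    (hupos : ∀ θ ∈ Θ, ∀ i j, 0 < u θ i j)
    (hdiff : ∀ i j, ∀ t ∈ Θ, DifferentiableAt ℝ (logProb u i j) t ∧
      DifferentiableAt ℝ (fderiv ℝ (logProb u i j)) t)
    {θ : EuclideanSpace ℝ (Fin m)} (hθ : θ ∈ Θ) : expHessian u θ = -fisher u θ := by
  ext k l
  rw [Matrix.neg_apply, fisher_apply, ← sum_fderiv_fderiv_logProb hΘ hu hupos hdiff hθ,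
    Fintype.sum_prod_type_right]
  simp only [expHessian, Matrix.sum_apply, Matrix.smul_apply, smul_eq_mul]
  exact Finset.sum_congr rfl fun i _ => Finset.sum_congr rfl fun j _ => by
    rw [hessian_apply i j (hdiff i j θ hθ).2]

lemma eq_sum_single (h : EuclideanSpace ℝ (Fin m)) :
    h = ∑ l, h l • EuclideanSpace.single l (1 : ℝ) := by
  ext k
  simp [Pi.single_apply]

lemma fisher_mulVec (θ h : EuclideanSpace ℝ (Fin m)) (k : Fin m) :
    (fisher u θ).mulVec h k = ∑ q : Fin (S + 1) × Fin (R + 1), u θ q.2 q.1 *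
      (fderiv ℝ (logProb u q.2 q.1) θ h
        * fderiv ℝ (logProb u q.2 q.1) θ (EuclideanSpace.single k 1)) := by
  have hlin : ∀ D : EuclideanSpace ℝ (Fin m) →L[ℝ] ℝ,
      D h = ∑ l, h l * D (EuclideanSpace.single l 1) := fun D => by
    conv_lhs => rw [eq_sum_single h]
    simp
  simp_rw [Matrix.mulVec, dotProduct, fisher_apply, hlin _, Finset.sum_mul, Finset.mul_sum]
  rw [Finset.sum_comm]
  exact Finset.sum_congr rfl fun q _ => Finset.sum_congr rfl fun l _ => by ring

lemma scoreMatrix_mulVec (θ : EuclideanSpace ℝ (Fin m)) (v : Fin (S + 1) × Fin (R + 1) → ℝ)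
    (k : Fin m) : (scoreMatrix u θ).mulVec v k =
      ∑ q, v q * fderiv ℝ (logProb u q.2 q.1) θ (EuclideanSpace.single k 1) := by
  simp only [Matrix.mulVec, dotProduct, scoreMatrix, Matrix.of_apply, score, partialD]
  exact Finset.sum_congr rfl fun q _ => mul_comm _ _

/-- The pseudo-score equation at an interior maximizer of the log-pseudo-likelihood. -/
lemma sum_smul_fderiv_logProb_of_isMaxOn (hΘ : IsOpen Θ)
    (hdiff : ∀ i j, ∀ t ∈ Θ, DifferentiableAt ℝ (logProb u i j) t) {Ω : Type*}
    {X : ℕ → Ω → Fin (R + 1)} {Y : ℕ → Ω → Fin (S + 1)} {n : ℕ} (hn : 0 < n) {ω : Ω}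
    {θ : EuclideanSpace ℝ (Fin m)} (hθ : θ ∈ Θ) (hmax : IsMaxOn (logPseudoLik u X Y n ω) Θ θ) :
    ∑ q : Fin (S + 1) × Fin (R + 1),
      empCopula X Y n ω q.2 q.1 • fderiv ℝ (logProb u q.2 q.1) θ = 0 := by
  have h0 := (hmax.isLocalMax (hΘ.mem_nhds hθ)).fderiv_eq_zero
  have h1 : HasFDerivAt (logPseudoLik u X Y n ω) ((n : ℝ) • ∑ q : Fin (S + 1) × Fin (R + 1),
      empCopula X Y n ω q.2 q.1 • fderiv ℝ (logProb u q.2 q.1) θ) θ := by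
    have h2 : logPseudoLik u X Y n ω = fun t => (n : ℝ) • ∑ q : Fin (S + 1) × Fin (R + 1),
        empCopula X Y n ω q.2 q.1 • logProb u q.2 q.1 t := by
      ext t
      rw [Fintype.sum_prod_type_right]
      rfl
    rw [h2]
    exact (HasFDerivAt.fun_sum fun q _ =>
      (hdiff q.2 q.1 θ hθ).hasFDerivAt.fun_const_smul _).fun_const_smul _
  rw [h1.fderiv] at h0
  exact (smul_eq_zero.1 h0).resolve_left (by positivity)

/-- The asymptotic expansion of solutions of the pseudo-score equation. -/
theorem sub_isLittleO_of_scoreEq (hΘ : IsOpen Θ) (hu : ∀ θ ∈ Θ, IsCopulaPMF (u θ))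
    (hupos : ∀ θ ∈ Θ, ∀ i j, 0 < u θ i j)
    (hdiff : ∀ i j, ∀ t ∈ Θ, DifferentiableAt ℝ (logProb u i j) t ∧
      DifferentiableAt ℝ (fderiv ℝ (logProb u i j)) t)
    {θ₀ : EuclideanSpace ℝ (Fin m)} (hθ₀ : θ₀ ∈ Θ) (hF : IsUnit (fisher u θ₀))
    {p : Matrix (Fin (R + 1)) (Fin (S + 1)) ℝ} (hp : ∀ i j, 0 < p i j)
    (hp1 : ∑ q, Matrix.vec p q = 1) (hodds : logOdds (u θ₀) = logOdds p) :
    (fun t : EuclideanSpace ℝ (Fin m) × (Fin (S + 1) × Fin (R + 1) → ℝ) =>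
        (t.1 - θ₀) - WithLp.toLp 2 (((fisher u θ₀)⁻¹ * scoreMatrix u θ₀ * Jmat (u θ₀) p).mulVec
          (t.2 - Matrix.vec p)))
      =o[𝓝[{t | ∑ q, t.2 q = 1 ∧ ∑ q : Fin (S + 1) × Fin (R + 1),
          toCopula (unvec t.2) q.2 q.1 • fderiv ℝ (logProb u q.2 q.1) t.1 = 0}]
        (θ₀, Matrix.vec p)] fun t => t.2 - Matrix.vec p := by
  set F := fisher u θ₀
  set W := scoreMatrix u θ₀
  set J := Jmat (u θ₀) p
  -- Restricting to total mass one and to solutions of the pseudo-score equation makes the expansion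
  -- deterministic.
  set T : Set (EuclideanSpace ℝ (Fin m) × (Fin (S + 1) × Fin (R + 1) → ℝ)) :=
    {t | ∑ q, t.2 q = 1 ∧ ∑ q : Fin (S + 1) × Fin (R + 1),
      toCopula (unvec t.2) q.2 q.1 • fderiv ℝ (logProb u q.2 q.1) t.1 = 0}
  set l := 𝓝[T] (θ₀, Matrix.vec p)
  have hdet : IsUnit F.det := (Matrix.isUnit_iff_isUnit_det _).1 hF
  have hd1 := fun i j t ht => (hdiff i j t ht).1
  have hfst : Tendsto Prod.fst l (𝓝 θ₀) := continuous_fst.continuousAt.tendsto.mono_left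
    nhdsWithin_le_nhds
  have hsnd : Tendsto Prod.snd l (𝓝[{x | ∑ q, x q = 1}] (Matrix.vec p)) := by
    refine tendsto_nhdsWithin_iff.2 ⟨continuous_snd.continuousAt.tendsto.mono_left
      nhdsWithin_le_nhds, ?_⟩
    filter_upwards [self_mem_nhdsWithin] with t ht using ht.1
  let v : EuclideanSpace ℝ (Fin m) × (Fin (S + 1) × Fin (R + 1) → ℝ) →
    Fin (S + 1) × Fin (R + 1) → ℝ := fun t => Matrix.vec (toCopula (unvec t.2))
  let q : EuclideanSpace ℝ (Fin m) × (Fin (S + 1) × Fin (R + 1) → ℝ) →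
    Fin (S + 1) × Fin (R + 1) → ℝ := fun t => t.2 - Matrix.vec p
  let h : EuclideanSpace ℝ (Fin m) × (Fin (S + 1) × Fin (R + 1) → ℝ) →
    EuclideanSpace ℝ (Fin m) := fun t => t.1 - θ₀
  have hq0 : Tendsto q l (𝓝 0) := by
    have := (tendsto_nhds_of_tendsto_nhdsWithin hsnd).sub_const (Matrix.vec p)
    rwa [sub_self] at this
  have hvJ : (fun t => v t - Matrix.vec (u θ₀) - J.mulVec (q t)) =o[l] q :=
    (toCopula_sub_isLittleO (hu θ₀ hθ₀) (hupos θ₀ hθ₀) hp hp1 hodds).comp_tendsto hsnd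
  have hJq : (fun t => J.mulVec (q t)) =O[l] q := (mulVecCLM J).isBigO_comp q l
  have hvO : (fun t => v t - Matrix.vec (u θ₀)) =O[l] q := by
    have := hvJ.isBigO.add hJq
    simpa using this
  have hv0 : Tendsto (fun t => v t - Matrix.vec (u θ₀)) l (𝓝 0) := hvO.trans_tendsto hq0
  have hlin : (fun t => F.mulVec (h t) - W.mulVec (v t - Matrix.vec (u θ₀))) =o[l] h := by
    refine Asymptotics.isLittleO_pi.2 fun k => ?_
    -- First-order Taylor remainder of the score at `θ₀`.
    let r : Fin (S + 1) × Fin (R + 1) →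
        EuclideanSpace ℝ (Fin m) × (Fin (S + 1) × Fin (R + 1) → ℝ) →
        EuclideanSpace ℝ (Fin m) →L[ℝ] ℝ := fun c t =>
      fderiv ℝ (logProb u c.2 c.1) t.1 - fderiv ℝ (logProb u c.2 c.1) θ₀
        - fderiv ℝ (fderiv ℝ (logProb u c.2 c.1)) θ₀ (h t)
    have hr : ∀ c, (fun t => r c t (EuclideanSpace.single k 1)) =o[l] h := fun c => by
      have h1 : r c =o[l] h := (hdiff c.2 c.1 θ₀ hθ₀).2.hasFDerivAt.isLittleO.comp_tendsto hfst
      exact ((ContinuousLinearMap.apply ℝ ℝ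
        (EuclideanSpace.single k (1 : ℝ))).isBigO_comp (r c) l).trans_isLittleO h1
    have hD : ∀ c : Fin (S + 1) × Fin (R + 1),
        (fun t => fderiv ℝ (fderiv ℝ (logProb u c.2 c.1)) θ₀ (h t) (EuclideanSpace.single k 1))
          =O[l] h := fun c =>
      ((ContinuousLinearMap.apply ℝ ℝ (EuclideanSpace.single k (1 : ℝ))).isBigO_comp _ l).trans
        ((fderiv ℝ (fderiv ℝ (logProb u c.2 c.1)) θ₀).isBigO_comp h l)
    have hv0c : ∀ c, (fun t => v t c - Matrix.vec (u θ₀) c) =o[l] fun _ => (1 : ℝ) := fun c =>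
      (Asymptotics.isLittleO_one_iff ℝ).2 ((tendsto_pi_nhds.1 hv0) c)
    have hvb : ∀ c, (fun t => v t c) =O[l] fun _ => (1 : ℝ) := fun c => by
      have := (hv0c c).isBigO.add (Asymptotics.isBigO_refl (fun _ => Matrix.vec (u θ₀) c) l |>.trans
        (Asymptotics.isBigO_const_const _ one_ne_zero l))
      simpa using this
    -- What remains of `F h - W (v - u)` after the score equations at `t` and `θ₀` and the
    -- information identity: a vanishing factor times `O(h)`, plus a bounded factor times `o(h)`.
    have hsum : (fun t => ∑ c : Fin (S + 1) × Fin (R + 1),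
        ((v t c - Matrix.vec (u θ₀) c) • fderiv ℝ (fderiv ℝ (logProb u c.2 c.1)) θ₀ (h t)
          (EuclideanSpace.single k 1) + v t c • r c t (EuclideanSpace.single k 1))) =o[l] h := by
      refine Asymptotics.IsLittleO.fun_sum fun c _ => Asymptotics.IsLittleO.add ?_ ?_
      · simpa using (hv0c c).smul_isBigO (hD c)
      · simpa using (hvb c).smul_isLittleO (hr c)
    refine hsum.congr' ?_ EventuallyEq.rfl
    filter_upwards [self_mem_nhdsWithin] with t ht
    have e1 : ∑ c, v t c * fderiv ℝ (logProb u c.2 c.1) t.1 (EuclideanSpace.single k 1) = 0 := by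
      have := congrArg (fun A => A (EuclideanSpace.single k 1)) ht.2
      simp only [sum_apply, smul_apply, smul_eq_mul, zero_apply] at this
      exact this
    have e2 : ∑ c, Matrix.vec (u θ₀) c
        * fderiv ℝ (logProb u c.2 c.1) θ₀ (EuclideanSpace.single k 1) = 0 := by
      have := congrArg (fun A => A (EuclideanSpace.single k 1))
        (sum_smul_fderiv_logProb hΘ hu hupos hd1 hθ₀)
      simp only [sum_apply, smul_apply, smul_eq_mul, zero_apply] at this
      exact this
    have e3 := sum_fderiv_fderiv_logProb hΘ hu hupos hdiff hθ₀ (h t) (EuclideanSpace.single k 1)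
    rw [Pi.sub_apply, fisher_mulVec, scoreMatrix_mulVec, ← neg_eq_iff_eq_neg.2 e3]
    simp only [r, smul_eq_mul, Pi.sub_apply, sub_apply]
    refine Eq.trans (b := -∑ c : Fin (S + 1) × Fin (R + 1), u θ₀ c.2 c.1
          * fderiv ℝ (fderiv ℝ (logProb u c.2 c.1)) θ₀ (h t) (EuclideanSpace.single k 1)
        - ∑ c, (v t c - Matrix.vec (u θ₀) c)
          * fderiv ℝ (logProb u c.2 c.1) θ₀ (EuclideanSpace.single k 1)
        + ∑ c, v t c * fderiv ℝ (logProb u c.2 c.1) t.1 (EuclideanSpace.single k 1)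
        - ∑ c, Matrix.vec (u θ₀) c
          * fderiv ℝ (logProb u c.2 c.1) θ₀ (EuclideanSpace.single k 1)) ?_ ?_
    · simp only [← Finset.sum_neg_distrib, ← Finset.sum_sub_distrib, ← Finset.sum_add_distrib]
      exact Finset.sum_congr rfl fun c _ => by simp only [Matrix.vec]; ring
    · rw [e1, e2, add_zero, sub_zero]
  have hN : (fun t => F⁻¹.mulVec (F.mulVec (h t) - W.mulVec (v t - Matrix.vec (u θ₀))))
      =o[l] h := ((mulVecCLM F⁻¹).isBigO_comp _ l).trans_isLittleO hlin
  have hM : (fun t => (F⁻¹ * W).mulVec (v t - Matrix.vec (u θ₀) - J.mulVec (q t))) =o[l] q :=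
    ((mulVecCLM (F⁻¹ * W)).isBigO_comp _ l).trans_isLittleO hvJ
  have hdec : ∀ t, (h t : Fin m → ℝ) - (F⁻¹ * W * J).mulVec (q t) =
      F⁻¹.mulVec (F.mulVec (h t) - W.mulVec (v t - Matrix.vec (u θ₀)))
      + (F⁻¹ * W).mulVec (v t - Matrix.vec (u θ₀) - J.mulVec (q t)) := fun t => by
    simp only [Matrix.mulVec_sub, Matrix.mulVec_mulVec, Matrix.nonsing_inv_mul _ hdet,
      Matrix.one_mulVec, Matrix.mul_assoc]
    abel
  have hequiv : h =O[l] fun t => (h t : Fin m → ℝ) :=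
    ((PiLp.continuousLinearEquiv 2 ℝ (fun _ : Fin m => ℝ)).symm :
      (Fin m → ℝ) →L[ℝ] EuclideanSpace ℝ (Fin m)).isBigO_comp (fun t => (h t : Fin m → ℝ)) l
  have hequiv' : (fun t => (h t : Fin m → ℝ)) =O[l] h :=
    ((PiLp.continuousLinearEquiv 2 ℝ (fun _ : Fin m => ℝ)) :
      EuclideanSpace ℝ (Fin m) →L[ℝ] (Fin m → ℝ)).isBigO_comp h l
  -- Bootstrap: `h` equals a term of order `q` plus an error `o(h)`, which is absorbed on the left.
  have hO : h =O[l] q := by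
    refine hequiv.trans (((hN.trans_isBigO hequiv).right_isBigO_sub).trans ?_)
    have h1 := ((mulVecCLM (F⁻¹ * W * J)).isBigO_comp q l).add hM.isBigO
    refine h1.congr_left fun t => ?_
    rw [mulVecCLM_apply, eq_sub_iff_add_eq, add_assoc, add_comm (Matrix.mulVec (F⁻¹ * W) _),
      ← hdec t]
    abel
  have hfin : (fun t => (h t : Fin m → ℝ) - (F⁻¹ * W * J).mulVec (q t)) =o[l] q := by
    simp_rw [hdec]
    exact (hN.trans_isBigO hO).add hM
  exact (((PiLp.continuousLinearEquiv 2 ℝ (fun _ : Fin m => ℝ)).symm :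
      (Fin m → ℝ) →L[ℝ] EuclideanSpace ℝ (Fin m)).isBigO_comp _ l).trans_isLittleO hfin

end Family

/-! ### Stochastic expansions -/

/-- A sequence that converges in distribution is bounded in probability. -/
lemma exists_measure_norm_ge_le {Ω E : Type*} [MeasurableSpace Ω] {μ : Measure Ω}
    [IsProbabilityMeasure μ] [NormedAddCommGroup E] [MeasurableSpace E] [BorelSpace E]
    {ν : Measure E} [IsProbabilityMeasure ν] {Z : ℕ → Ω → E}
    (h : TendstoInDistribution Z atTop id (fun _ => μ) ν) {α : ENNReal} (hα : 0 < α) :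
    ∃ K : ℝ, 0 < K ∧ ∀ᶠ n in atTop, μ {ω | K ≤ ‖Z n ω‖} ≤ α := by
  have hmeas : ∀ K : ℝ, MeasurableSet {x : E | K ≤ ‖x‖} := fun K =>
    (isClosed_le continuous_const continuous_norm).measurableSet
  -- Continuity from above of the limit law; the portmanteau bound for closed sets then transfers
  -- the tail estimate to `Z n`.
  have hlim : Tendsto (fun k : ℕ => ν {x : E | (k : ℝ) ≤ ‖x‖}) atTop (𝓝 0) := by
    have h1 := tendsto_measure_iInter_atTop (μ := ν) (s := fun k : ℕ => {x : E | (k : ℝ) ≤ ‖x‖})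
      (fun k => (hmeas k).nullMeasurableSet)
      (fun a b hab x hx => show (a : ℝ) ≤ ‖x‖ from
        (Nat.cast_le.2 hab).trans (show (b : ℝ) ≤ ‖x‖ from hx)) ⟨0, measure_ne_top _ _⟩
    have h2 : (⋂ k : ℕ, {x : E | (k : ℝ) ≤ ‖x‖}) = ∅ := by
      refine Set.eq_empty_iff_forall_notMem.2 fun x hx => ?_
      obtain ⟨k, hk⟩ := exists_nat_gt ‖x‖
      exact absurd (Set.mem_iInter.1 hx k) (not_le.2 hk)
    rwa [h2, measure_empty] at h1
  obtain ⟨k, hk, hk0⟩ := ((hlim.eventually_lt_const hα).and (eventually_gt_atTop 0)).exists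
  refine ⟨k, Nat.cast_pos.2 hk0, ?_⟩
  have h3 := ProbabilityMeasure.limsup_measure_closed_le_of_tendsto h.tendsto
    (isClosed_le continuous_const continuous_norm : IsClosed {x : E | (k : ℝ) ≤ ‖x‖})
  have h4 : limsup (fun n => μ {ω | (k : ℝ) ≤ ‖Z n ω‖}) atTop < α := by
    refine lt_of_le_of_lt ?_ hk
    simp only [ProbabilityMeasure.coe_mk, Measure.map_id] at h3
    refine le_trans (le_of_eq ?_) h3
    congr 1
    ext n
    rw [Measure.map_apply_of_aemeasurable (h.forall_aemeasurable n) (hmeas k)]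
    rfl
  exact (eventually_lt_of_limsup_lt h4).mono fun n hn => hn.le

/-- From a deterministic first-order expansion to a stochastic one: `x n` is a perturbation of
order `1 / n` of `y n`, and `√n (y n - p)` is bounded in probability. -/
lemma tendstoInMeasure_sqrt_smul_sub {Ω E V : Type*} [MeasurableSpace Ω] {μ : Measure Ω}
    [NormedAddCommGroup E] [NormedSpace ℝ E] [NormedAddCommGroup V] [NormedSpace ℝ V]
    {T : Set (E × V)} {θ₀ : E} {p : V} (B : V →L[ℝ] E)
    (hB : (fun t : E × V => (t.1 - θ₀) - B (t.2 - p)) =o[𝓝[T] (θ₀, p)] fun t => t.2 - p)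
    {θ : ℕ → Ω → E} {x y : ℕ → Ω → V} (hθ : TendstoInMeasure μ θ atTop fun _ => θ₀)
    (hT : ∀ n, 0 < n → ∀ᵐ ω ∂μ, (θ n ω, x n ω) ∈ T)
    (hxy : ∀ n, 0 < n → ∀ ω, ‖x n ω - y n ω‖ ≤ 1 / (n : ℝ))
    (hy : ∀ α : ENNReal, 0 < α →
      ∃ K : ℝ, 0 < K ∧ ∀ᶠ n : ℕ in atTop, μ {ω | K ≤ ‖√(n : ℝ) • (y n ω - p)‖} ≤ α) :
    TendstoInMeasure μ (fun (n : ℕ) ω => √(n : ℝ) • (θ n ω - θ₀) - B (√(n : ℝ) • (y n ω - p)))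
      atTop fun _ => 0 := by
  rw [tendstoInMeasure_iff_norm] at hθ ⊢
  intro η hη
  rw [ENNReal.tendsto_nhds_zero]
  intro α hα
  have hα2 : 0 < α / 2 := ENNReal.div_pos hα.ne' (by simp)
  obtain ⟨K, hK, hKα⟩ := hy (α / 2) hα2
  -- On the good event `√n ‖x n - p‖ ≤ K + 1`, so this choice keeps the scaled remainder below `η /
  -- 2`; the other half covers the smoothing error, at most `‖B‖ / √n`.
  have hε : 0 < η / (2 * (K + 1)) := by positivity
  obtain ⟨δ, hδ, hball⟩ := Metric.mem_nhdsWithin_iff.1 (hB.def hε)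
  have hinv : Tendsto (fun n : ℕ => (√(n : ℝ))⁻¹) atTop (𝓝 0) :=
    tendsto_inv_atTop_zero.comp (Real.tendsto_sqrt_atTop.comp tendsto_natCast_atTop_atTop)
  have hev1 : ∀ᶠ n : ℕ in atTop, (√(n : ℝ))⁻¹ < 1 := hinv.eventually_lt_const one_pos
  have hev2 : ∀ᶠ n : ℕ in atTop, ‖B‖ * (√(n : ℝ))⁻¹ < η / 2 := by
    have := hinv.const_mul ‖B‖
    rw [mul_zero] at this
    exact this.eventually_lt_const (by positivity)
  have hev3 : ∀ᶠ n : ℕ in atTop, (K + 1) * (√(n : ℝ))⁻¹ < δ := by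
    have := hinv.const_mul (K + 1)
    rw [mul_zero] at this
    exact this.eventually_lt_const hδ
  have hev4 : ∀ᶠ n in atTop, μ {ω | δ ≤ ‖θ n ω - θ₀‖} ≤ α / 2 :=
    (ENNReal.tendsto_nhds_zero.1 (hθ δ hδ)) _ hα2
  filter_upwards [hev1, hev2, hev3, hev4, hKα, eventually_gt_atTop 0] with n h1 h2 h3 h4 h5 hn
  have hs : 0 < √(n : ℝ) := Real.sqrt_pos.2 (Nat.cast_pos.2 hn)
  have hss : √(n : ℝ) * √(n : ℝ) = n := Real.mul_self_sqrt (Nat.cast_nonneg n)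
  have hsub : μ {ω | η ≤ ‖√(n : ℝ) • (θ n ω - θ₀) - B (√(n : ℝ) • (y n ω - p)) - 0‖} ≤
      μ ({ω | δ ≤ ‖θ n ω - θ₀‖} ∪ {ω | K ≤ ‖√(n : ℝ) • (y n ω - p)‖}) := by
    refine measure_mono_ae ?_
    filter_upwards [hT n hn] with ω hω hbig
    by_contra hnot
    obtain ⟨hn1, hn2⟩ := not_or.1 hnot
    have hn1' : ‖θ n ω - θ₀‖ < δ := not_le.1 hn1
    have hn2' : ‖√(n : ℝ) • (y n ω - p)‖ < K := not_le.1 hn2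
    have hxy' : √(n : ℝ) * ‖x n ω - y n ω‖ ≤ (√(n : ℝ))⁻¹ := by
      refine (mul_le_mul_of_nonneg_left (hxy n hn ω) hs.le).trans (le_of_eq ?_)
      rw [mul_one_div, div_eq_iff (Nat.cast_pos.2 hn).ne', inv_mul_eq_div, eq_div_iff hs.ne', hss]
    have hx : √(n : ℝ) * ‖x n ω - p‖ ≤ K + 1 := by
      have e : x n ω - p = (x n ω - y n ω) + (y n ω - p) := by abel
      rw [e]
      calc √(n : ℝ) * ‖(x n ω - y n ω) + (y n ω - p)‖
          ≤ √(n : ℝ) * (‖x n ω - y n ω‖ + ‖y n ω - p‖) := by gcongr; exact norm_add_le _ _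
        _ = √(n : ℝ) * ‖x n ω - y n ω‖ + ‖√(n : ℝ) • (y n ω - p)‖ := by
          rw [norm_smul, Real.norm_of_nonneg hs.le]; ring
        _ ≤ K + 1 := by linarith
    have hxδ : ‖x n ω - p‖ < δ := by
      refine lt_of_le_of_lt ?_ h3
      rw [← div_eq_mul_inv, le_div_iff₀ hs]
      linarith
    have hmain : ‖(θ n ω - θ₀) - B (x n ω - p)‖ ≤ η / (2 * (K + 1)) * ‖x n ω - p‖ := by
      refine hball (a := (θ n ω, x n ω)) ⟨?_, hω⟩
      rw [Metric.mem_ball, Prod.dist_eq, max_lt_iff, dist_eq_norm, dist_eq_norm]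
      exact ⟨hn1', hxδ⟩
    have hdec : √(n : ℝ) • (θ n ω - θ₀) - B (√(n : ℝ) • (y n ω - p)) - 0 =
        √(n : ℝ) • ((θ n ω - θ₀) - B (x n ω - p)) + √(n : ℝ) • B (x n ω - y n ω) := by
      rw [map_smul, ← smul_add, sub_zero, ← smul_sub]
      congr 1
      simp only [map_sub]
      abel
    have hlt : ‖√(n : ℝ) • (θ n ω - θ₀) - B (√(n : ℝ) • (y n ω - p)) - 0‖ < η := by
      rw [hdec]
      refine (norm_add_le _ _).trans_lt ?_
      rw [norm_smul, norm_smul, Real.norm_of_nonneg hs.le]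
      have i1 : √(n : ℝ) * ‖(θ n ω - θ₀) - B (x n ω - p)‖ ≤ η / 2 := by
        calc √(n : ℝ) * ‖(θ n ω - θ₀) - B (x n ω - p)‖
            ≤ √(n : ℝ) * (η / (2 * (K + 1)) * ‖x n ω - p‖) := by gcongr
          _ = η / (2 * (K + 1)) * (√(n : ℝ) * ‖x n ω - p‖) := by ring
          _ ≤ η / (2 * (K + 1)) * (K + 1) := by gcongr
          _ = η / 2 := by field_simp
      have i2 : √(n : ℝ) * ‖B (x n ω - y n ω)‖ ≤ ‖B‖ * (√(n : ℝ))⁻¹ := by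
        calc √(n : ℝ) * ‖B (x n ω - y n ω)‖
            ≤ √(n : ℝ) * (‖B‖ * ‖x n ω - y n ω‖) := by gcongr; exact B.le_opNorm _
          _ = ‖B‖ * (√(n : ℝ) * ‖x n ω - y n ω‖) := by ring
          _ ≤ ‖B‖ * (√(n : ℝ))⁻¹ := by gcongr
      linarith
    exact absurd hbig (not_le.2 hlt)
  calc _ ≤ _ := hsub
    _ ≤ _ := measure_union_le _ _
    _ ≤ α / 2 + α / 2 := add_le_add h4 h5
    _ = α := ENNReal.add_halves α

/-! ### The empirical p.m.f. -/

section Empirical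

variable {Ω : Type*} {X : ℕ → Ω → Fin (R + 1)} {Y : ℕ → Ω → Fin (S + 1)}

lemma sum_ite_eq_one (i₀ : Fin (R + 1)) (j₀ : Fin (S + 1))
    (t : Fin (S + 1) × Fin (R + 1) → ℝ) :
    ∑ q : Fin (S + 1) × Fin (R + 1), t q * (if i₀ = q.2 ∧ j₀ = q.1 then (1 : ℝ) else 0) =
      t (j₀, i₀) := by
  rw [Finset.sum_eq_single (j₀, i₀)]
  · simp
  · rintro ⟨j, i⟩ - hne
    rw [if_neg, mul_zero]
    rintro ⟨rfl, rfl⟩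
    exact hne rfl
  · simp

lemma count_nonneg (n : ℕ) (ω : Ω) (i : Fin (R + 1)) (j : Fin (S + 1)) :
    (0 : ℝ) ≤ ∑ k ∈ Finset.range n, if X k ω = i ∧ Y k ω = j then 1 else 0 :=
  Finset.sum_nonneg fun k _ => by split_ifs <;> simp

lemma count_le (n : ℕ) (ω : Ω) (i : Fin (R + 1)) (j : Fin (S + 1)) :
    (∑ k ∈ Finset.range n, if X k ω = i ∧ Y k ω = j then (1 : ℝ) else 0) ≤ n := by
  have := Finset.sum_le_card_nsmul (Finset.range n)
    (fun k => if X k ω = i ∧ Y k ω = j then (1 : ℝ) else 0) 1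
    fun k _ => by split_ifs <;> simp
  simpa using this

lemma sum_vec_smoothPMF (n : ℕ) (ω : Ω) : ∑ q, Matrix.vec (smoothPMF X Y n ω) q = 1 := by
  have h1 : ∑ q : Fin (S + 1) × Fin (R + 1), ∑ k ∈ Finset.range n,
      (if X k ω = q.2 ∧ Y k ω = q.1 then (1 : ℝ) else 0) = n := by
    rw [Finset.sum_comm]
    have := fun k => sum_ite_eq_one (X k ω) (Y k ω) fun _ => 1
    simp only [one_mul] at this
    simp [this]
  simp only [Matrix.vec, smoothPMF, Matrix.of_apply, ← Finset.mul_sum, Finset.sum_add_distrib, h1]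
  simp
  field_simp

/-- For a cell count `N` and `c = 1/(rs)` the difference is `(n c - N) / (n (n + 1))`, and both `n
c` and `N` lie between `0` and `n`. -/
lemma norm_vec_smoothPMF_sub_le {n : ℕ} (hn : 0 < n) (ω : Ω) :
    ‖Matrix.vec (smoothPMF X Y n ω) - Matrix.vec (empPMF X Y n ω)‖ ≤ 1 / (n : ℝ) := by
  refine (pi_norm_le_iff_of_nonneg (by positivity)).2 fun q => ?_
  have hn' : (0 : ℝ) < n := Nat.cast_pos.2 hn
  simp only [Pi.sub_apply, Matrix.vec, smoothPMF, empPMF, Matrix.of_apply]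
  have h0 := count_nonneg (X := X) (Y := Y) n ω q.2 q.1
  have h1 := count_le (X := X) (Y := Y) n ω q.2 q.1
  set N := ∑ k ∈ Finset.range n, if X k ω = q.2 ∧ Y k ω = q.1 then (1 : ℝ) else 0
  have hc0 : 0 ≤ 1 / (((R : ℝ) + 1) * ((S : ℝ) + 1)) := by positivity
  have hc1 : 1 / (((R : ℝ) + 1) * ((S : ℝ) + 1)) ≤ 1 := by
    rw [div_le_one (by positivity)]
    nlinarith [Nat.cast_nonneg (α := ℝ) R, Nat.cast_nonneg (α := ℝ) S,
      mul_nonneg (Nat.cast_nonneg (α := ℝ) R) (Nat.cast_nonneg (α := ℝ) S)]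
  set c := 1 / (((R : ℝ) + 1) * ((S : ℝ) + 1))
  have e : 1 / ((n : ℝ) + 1) * (N + c) - 1 / (n : ℝ) * N = (n * c - N) / (n * (n + 1)) := by
    field_simp
    ring
  have hb : |n * c - N| ≤ n := abs_le.2 ⟨by nlinarith, by nlinarith⟩
  rw [e, Real.norm_eq_abs, abs_div, abs_of_pos (by positivity : (0 : ℝ) < n * (n + 1)),
    div_le_div_iff₀ (by positivity) hn']
  nlinarith

variable [MeasurableSpace Ω] {μ : Measure Ω}

lemma measurable_vec_empPMF (hX : ∀ k, Measurable (X k)) (hY : ∀ k, Measurable (Y k)) (n : ℕ) :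
    Measurable fun ω => Matrix.vec (empPMF X Y n ω) := by
  refine measurable_pi_lambda _ fun q => ?_
  simp only [Matrix.vec, empPMF, Matrix.of_apply]
  refine Measurable.const_mul (Finset.measurable_sum _ fun k _ => ?_) _
  exact Measurable.ite ((hX k (measurableSet_singleton q.2)).inter
    (hY k (measurableSet_singleton q.1))) measurable_const measurable_const

variable [IsProbabilityMeasure μ] {p : Matrix (Fin (R + 1)) (Fin (S + 1)) ℝ}

lemma integral_comp_pair (hX : ∀ k, Measurable (X k)) (hY : ∀ k, Measurable (Y k))
    (hXY : ∀ k i j, μ.real {ω | X k ω = i ∧ Y k ω = j} = p i j) (k : ℕ)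
    (t : Fin (S + 1) × Fin (R + 1) → ℝ) :
    ∫ ω, t (Y k ω, X k ω) ∂μ = ∑ q, Matrix.vec p q * t q := by
  have hmeas : Measurable fun ω => (Y k ω, X k ω) := (hY k).prodMk (hX k)
  have := Measure.isProbabilityMeasure_map hmeas.aemeasurable (μ := μ)
  rw [← integral_map (f := t) hmeas.aemeasurable
    (measurable_of_countable t).aestronglyMeasurable, integral_fintype .of_finite]
  refine Finset.sum_congr rfl fun q _ => ?_
  rw [map_measureReal_apply hmeas (measurableSet_singleton q), smul_eq_mul, Matrix.vec,
    ← hXY k q.2 q.1]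
  congr 2
  ext ω
  simp [Prod.ext_iff, and_comm]

lemma sum_vec_eq_one (hX : ∀ k, Measurable (X k)) (hY : ∀ k, Measurable (Y k))
    (hXY : ∀ k i j, μ.real {ω | X k ω = i ∧ Y k ω = j} = p i j) : ∑ q, Matrix.vec p q = 1 := by
  have := integral_comp_pair hX hY hXY 0 fun _ => 1
  simpa using this.symm

/-- Serves twice: it makes `covMat p` positive semidefinite and gives the exponent of the limiting
characteristic function. -/
lemma variance_comp_pair (hX : ∀ k, Measurable (X k)) (hY : ∀ k, Measurable (Y k))
    (hXY : ∀ k i j, μ.real {ω | X k ω = i ∧ Y k ω = j} = p i j)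
    (t : Fin (S + 1) × Fin (R + 1) → ℝ) :
    Var[fun ω => t (Y 0 ω, X 0 ω); μ] = t ⬝ᵥ (covMat p).mulVec t := by
  have hmeas : Measurable fun ω => t (Y 0 ω, X 0 ω) :=
    (measurable_of_countable t).comp ((hY 0).prodMk (hX 0))
  have hmem : MemLp (fun ω => t (Y 0 ω, X 0 ω)) 2 μ :=
    MemLp.of_bound hmeas.aestronglyMeasurable ‖t‖ (ae_of_all _ fun ω => norm_le_pi_norm t _)
  rw [variance_eq_sub hmem]
  simp only [Pi.pow_apply]
  rw [integral_comp_pair hX hY hXY 0 t, integral_comp_pair hX hY hXY 0 fun q => t q ^ 2, covMat,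
    Matrix.sub_mulVec, dotProduct_sub]
  congr 1
  · simp only [dotProduct, Matrix.mulVec_diagonal]
    exact Finset.sum_congr rfl fun q _ => by ring
  · rw [Matrix.vecMulVec_mulVec]
    simp only [dotProduct, Pi.smul_apply, op_smul_eq_smul, smul_eq_mul, sq,
      Finset.sum_mul, Finset.mul_sum]
    exact Finset.sum_congr rfl fun q _ => Finset.sum_congr rfl fun q' _ => by ring

lemma posSemidef_covMat (hX : ∀ k, Measurable (X k)) (hY : ∀ k, Measurable (Y k))
    (hXY : ∀ k i j, μ.real {ω | X k ω = i ∧ Y k ω = j} = p i j) : (covMat p).PosSemidef := by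
  refine Matrix.PosSemidef.of_dotProduct_mulVec_nonneg ?_ fun t => ?_
  · ext q q'
    simp [covMat, Matrix.vecMulVec_apply, Matrix.diagonal_apply, mul_comm, @eq_comm _ q q']
    split_ifs with h
    · rw [h]
    · rfl
  · rw [star_trivial, ← variance_comp_pair hX hY hXY t]
    exact variance_nonneg _ _

/-- The multivariate central limit theorem for linear images of the empirical p.m.f. -/
theorem tendstoInDistribution_mulVec_empPMF (hX : ∀ k, Measurable (X k))
    (hY : ∀ k, Measurable (Y k)) (hXY : ∀ k i j, μ.real {ω | X k ω = i ∧ Y k ω = j} = p i j)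
    (hind : iIndepFun (fun k ω => (X k ω, Y k ω)) μ) {ι : Type*} [Fintype ι] [DecidableEq ι]
    (B : Matrix ι (Fin (S + 1) × Fin (R + 1)) ℝ) :
    TendstoInDistribution
      (fun (n : ℕ) ω => WithLp.toLp 2 (B.mulVec (√(n : ℝ) • Matrix.vec (empPMF X Y n ω - p))))
      atTop id (fun _ => μ) (multivariateGaussian 0 (B * covMat p * B.transpose)) := by
  have hZmeas : ∀ n : ℕ, Measurable fun ω =>
      WithLp.toLp 2 (B.mulVec (√(n : ℝ) • Matrix.vec (empPMF X Y n ω - p))) := fun n => by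
    have h1 : Continuous fun v : Fin (S + 1) × Fin (R + 1) → ℝ =>
        WithLp.toLp 2 (B.mulVec (√(n : ℝ) • (v - Matrix.vec p))) :=
      (PiLp.continuous_toLp 2 _).comp ((mulVecCLM B).continuous.comp (by fun_prop))
    exact h1.measurable.comp (measurable_vec_empPMF hX hY n)
  refine ⟨fun n => (hZmeas n).aemeasurable, aemeasurable_id, ?_⟩
  refine ProbabilityMeasure.tendsto_iff_tendsto_charFun.2 fun t => ?_
  have hpsd : (B * covMat p * B.transpose).PosSemidef :=
    (posSemidef_covMat hX hY hXY).mul_mul_conjTranspose_same B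
  -- Cramér–Wold: pairing with `t` reduces the claim to the scalar central limit theorem for `W k`,
  -- whose characteristic functions are then compared at `1`.
  set s : Fin (S + 1) × Fin (R + 1) → ℝ := B.transpose.mulVec t
  let W : ℕ → Ω → ℝ := fun k ω => s (Y k ω, X k ω)
  have hpair : ∀ k, Measurable fun ω => (X k ω, Y k ω) := fun k => (hX k).prodMk (hY k)
  have hident : ∀ k, IdentDistrib (W k) (W 0) μ μ := fun k => by
    have h1 : IdentDistrib (fun ω => (X k ω, Y k ω)) (fun ω => (X 0 ω, Y 0 ω)) μ μ := by
      refine ⟨(hpair k).aemeasurable, (hpair 0).aemeasurable, ?_⟩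
      refine Measure.ext_of_singleton fun q => ?_
      rw [Measure.map_apply (hpair k) (measurableSet_singleton q),
        Measure.map_apply (hpair 0) (measurableSet_singleton q),
        ← measureReal_eq_measureReal_iff]
      have h2 : ∀ k, (fun ω => (X k ω, Y k ω)) ⁻¹' {q} = {ω | X k ω = q.1 ∧ Y k ω = q.2} :=
        fun k => by ext ω; simp [Prod.ext_iff]
      rw [h2, h2, hXY, hXY]
    exact h1.comp (u := fun q => s (q.2, q.1)) (measurable_of_countable _)
  have hindW : iIndepFun W μ :=
    hind.comp (fun _ q => s (q.2, q.1)) fun _ => measurable_of_countable _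
  have hmem : MemLp (W 0) 2 μ :=
    MemLp.of_bound (hident 0).aemeasurable_fst.aestronglyMeasurable ‖s‖
      (ae_of_all _ fun ω => norm_le_pi_norm s _)
  have hclt := (tendstoInDistribution_inv_sqrt_mul_sum_sub (P' := gaussianReal 0 Var[W 0; μ].toNNReal)
    (Y := id) HasLaw.id hmem hindW hident).tendsto
  have hchar := ProbabilityMeasure.tendsto_iff_tendsto_charFun.1 hclt 1
  simp only [ProbabilityMeasure.coe_mk, Measure.map_id] at hchar ⊢
  have hWvar : Var[W 0; μ] = s ⬝ᵥ (covMat p).mulVec s := variance_comp_pair hX hY hXY s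
  have hlimit : charFun (gaussianReal 0 Var[W 0; μ].toNNReal) 1 =
      charFun (multivariateGaussian 0 (B * covMat p * B.transpose)) t := by
    rw [charFun_gaussianReal, charFun_multivariateGaussian hpsd, Real.coe_toNNReal _
      (variance_nonneg _ _), hWvar]
    have : (t : ι → ℝ) ⬝ᵥ (B * covMat p * B.transpose).mulVec t = s ⬝ᵥ (covMat p).mulVec s := by
      rw [← Matrix.mulVec_mulVec, ← Matrix.mulVec_mulVec, Matrix.dotProduct_mulVec,
        ← Matrix.mulVec_transpose]
    rw [this]
    simp
  rw [hlimit] at hchar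
  refine hchar.congr fun n => ?_
  have hmeasW : Measurable fun ω =>
      (√(n : ℝ))⁻¹ * (∑ k ∈ Finset.range n, W k ω - n * ∫ ω, W 0 ω ∂μ) :=
    ((Finset.measurable_sum _ fun k _ =>
      (measurable_of_countable s).comp ((hY k).prodMk (hX k))).sub_const _).const_mul _
  rw [charFun_apply, charFun_apply, integral_map hmeasW.aemeasurable (by fun_prop),
    integral_map (hZmeas n).aemeasurable (by fun_prop)]
  refine integral_congr_ae (ae_of_all _ fun ω => ?_)
  have hinner : inner ℝ (WithLp.toLp 2
      (B.mulVec (√(n : ℝ) • Matrix.vec (empPMF X Y n ω - p)))) t =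
      (√(n : ℝ))⁻¹ * (∑ k ∈ Finset.range n, W k ω - n * ∫ ω, W 0 ω ∂μ) := by
    have h1 : inner ℝ (WithLp.toLp 2
        (B.mulVec (√(n : ℝ) • Matrix.vec (empPMF X Y n ω - p)))) t =
        s ⬝ᵥ (√(n : ℝ) • Matrix.vec (empPMF X Y n ω - p)) := by
      rw [EuclideanSpace.inner_eq_star_dotProduct, star_trivial, Matrix.dotProduct_mulVec,
        ← Matrix.mulVec_transpose]
    have h2 : ∑ k ∈ Finset.range n, W k ω = ∑ q, s q *
        ∑ k ∈ Finset.range n, if X k ω = q.2 ∧ Y k ω = q.1 then (1 : ℝ) else 0 := by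
      simp_rw [Finset.mul_sum]
      rw [Finset.sum_comm]
      exact Finset.sum_congr rfl fun k _ => (sum_ite_eq_one (X k ω) (Y k ω) s).symm
    have h3 : ∫ ω, W 0 ω ∂μ = ∑ q, Matrix.vec p q * s q := integral_comp_pair hX hY hXY 0 s
    rw [h1, h2, h3]
    rcases Nat.eq_zero_or_pos n with rfl | hn
    · simp
    have hsq : 0 < √(n : ℝ) := Real.sqrt_pos.2 (Nat.cast_pos.2 hn)
    have hss : (n : ℝ) = √(n : ℝ) * √(n : ℝ) := (Real.mul_self_sqrt (Nat.cast_nonneg n)).symm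
    have hn1 : √(n : ℝ) * (1 / (n : ℝ)) = (√(n : ℝ))⁻¹ := by
      rw [hss, Real.sqrt_mul_self hsq.le]
      field_simp
    have hn2 : √(n : ℝ) = (√(n : ℝ))⁻¹ * n := by
      conv_rhs => rw [hss, Real.sqrt_mul_self hsq.le]
      field_simp
    simp only [dotProduct, Pi.smul_apply, smul_eq_mul]
    rw [Finset.mul_sum, ← Finset.sum_sub_distrib, Finset.mul_sum]
    refine Finset.sum_congr rfl fun q _ => ?_
    simp only [Matrix.vec, Matrix.sub_apply, empPMF, Matrix.of_apply]
    rw [mul_sub, ← mul_assoc √(n : ℝ), hn1, mul_sub, mul_sub]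
    congr 1
    · ring
    · rw [← mul_assoc (√(n : ℝ))⁻¹, ← hn2]
      ring
  beta_reduce
  rw [hinner]
  simp

end Empirical

end

end CopulaPMF

/-! ### Assembly of the proposition -/

theorem proposition3p6 {R S m : ℕ} (hm : 0 < m)
    {Ω : Type*} [MeasurableSpace Ω] (μ : Measure Ω) [IsProbabilityMeasure μ]
    -- the strictly positive p.m.f. `p` and the observations, copies of a vector with p.m.f. `p`
    (p : Matrix (Fin (R + 1)) (Fin (S + 1)) ℝ) (hp : ∀ i j, 0 < p i j)
    (X : ℕ → Ω → Fin (R + 1)) (Y : ℕ → Ω → Fin (S + 1))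
    (hX : ∀ k, Measurable (X k)) (hY : ∀ k, Measurable (Y k))
    (hXY : ∀ k i j, μ.real {ω | X k ω = i ∧ Y k ω = j} = p i j)
    -- the parametric family of strictly positive copula p.m.f.s, containing that of `p`
    (Θ : Set (EuclideanSpace ℝ (Fin m))) (hΘ : IsOpen Θ)
    (u : EuclideanSpace ℝ (Fin m) → Matrix (Fin (R + 1)) (Fin (S + 1)) ℝ)
    (hu : ∀ θ ∈ Θ, IsCopulaPMF (u θ)) (hupos : ∀ θ ∈ Θ, ∀ i j, 0 < u θ i j)
    (θ₀ : EuclideanSpace ℝ (Fin m)) (hθ₀ : θ₀ ∈ Θ) (hup : IsCopulaPMFOf (u θ₀) p)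
    -- the maximum pseudo-likelihood estimator
    (θ : ℕ → Ω → EuclideanSpace ℝ (Fin m)) (hθmeas : ∀ n, Measurable (θ n))
    (hθ : ∀ n, 0 < n → ∀ᵐ ω ∂μ, θ n ω ∈ Θ ∧ IsMaxOn (logPseudoLik u X Y n ω) Θ (θ n ω))
    -- consistency, twice differentiability, invertibility of the expected Hessian
    (hcons : TendstoInMeasure μ θ atTop (fun _ => θ₀))
    (hdiff : ∀ i j, ∀ t ∈ Θ, DifferentiableAt ℝ (logProb u i j) t ∧
      DifferentiableAt ℝ (fderiv ℝ (logProb u i j)) t)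
    (hinv : IsUnit (expHessian u θ₀)) :
    -- the two matrices inverted below are invertible
    IsUnit (Lmat (u θ₀)) ∧ IsUnit (fisher u θ₀) ∧
    -- the asymptotic linear representation
    (∀ (ν : Measure (EuclideanSpace ℝ (Fin (S + 1) × Fin (R + 1)))) [IsProbabilityMeasure ν],
      TendstoInDistribution
        (fun (n : ℕ) ω => √(n : ℝ) • WithLp.toLp 2 (Matrix.vec (empPMF X Y n ω - p)))
        atTop id (fun _ => μ) ν →
      TendstoInMeasure μ
        (fun (n : ℕ) ω => √(n : ℝ) • (θ n ω - θ₀) -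
          WithLp.toLp 2 (((fisher u θ₀)⁻¹ * scoreMatrix u θ₀ * Jmat (u θ₀) p).mulVec
            (√(n : ℝ) • Matrix.vec (empPMF X Y n ω - p))))
        atTop (fun _ => 0)) ∧
    -- asymptotic normality under independent sampling
    (iIndepFun (fun k ω => (X k ω, Y k ω)) μ →
      TendstoInDistribution (fun (n : ℕ) ω => √(n : ℝ) • (θ n ω - θ₀)) atTop id (fun _ => μ)
        (multivariateGaussian 0
          ((fisher u θ₀)⁻¹ * scoreMatrix u θ₀ * Jmat (u θ₀) p * covMat p * (Jmat (u θ₀) p).transpose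
            * (scoreMatrix u θ₀).transpose * ((fisher u θ₀)⁻¹).transpose))) := by
  have hF : IsUnit (fisher u θ₀) := by
    rw [expHessian_eq_neg_fisher hΘ hu hupos hdiff hθ₀] at hinv
    exact (IsUnit.neg_iff _).1 hinv
  have hp1 : ∑ q, Matrix.vec p q = 1 := sum_vec_eq_one hX hY hXY
  have hodds : logOdds (u θ₀) = logOdds p :=
    (logOdds_eq_of_ipfpTendsto (rowSum_pos hp) (colSum_pos hp) (hupos θ₀ hθ₀) hp hup.tendsto).symm
  have hd1 := fun i j t ht => (hdiff i j t ht).1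
  have hlin : ∀ (ν : Measure (EuclideanSpace ℝ (Fin (S + 1) × Fin (R + 1))))
      [IsProbabilityMeasure ν],
      TendstoInDistribution
        (fun (n : ℕ) ω => √(n : ℝ) • WithLp.toLp 2 (Matrix.vec (empPMF X Y n ω - p)))
        atTop id (fun _ => μ) ν →
      TendstoInMeasure μ
        (fun (n : ℕ) ω => √(n : ℝ) • (θ n ω - θ₀) -
          WithLp.toLp 2 (((fisher u θ₀)⁻¹ * scoreMatrix u θ₀ * Jmat (u θ₀) p).mulVec
            (√(n : ℝ) • Matrix.vec (empPMF X Y n ω - p))))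
        atTop (fun _ => 0) := by
    intro ν _ hν
    refine tendstoInMeasure_sqrt_smul_sub
      (((PiLp.continuousLinearEquiv 2 ℝ (fun _ : Fin m => ℝ)).symm :
        (Fin m → ℝ) →L[ℝ] EuclideanSpace ℝ (Fin m)).comp
          (mulVecCLM ((fisher u θ₀)⁻¹ * scoreMatrix u θ₀ * Jmat (u θ₀) p)))
      (sub_isLittleO_of_scoreEq hΘ hu hupos hdiff hθ₀ hF hp hp1 hodds)
      (x := fun n ω => Matrix.vec (smoothPMF X Y n ω))
      (y := fun n ω => Matrix.vec (empPMF X Y n ω)) hcons ?_ ?_ ?_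
    · intro n hn
      filter_upwards [hθ n hn] with ω hω
      exact ⟨sum_vec_smoothPMF n ω, sum_smul_fderiv_logProb_of_isMaxOn hΘ hd1 hn hω.1 hω.2⟩
    · exact fun n hn ω => norm_vec_smoothPMF_sub_le hn ω
    · intro α hα
      obtain ⟨K, hK, hKα⟩ := exists_measure_norm_ge_le hν hα
      refine ⟨K, hK, hKα.mono fun n hn => (measure_mono fun ω hω => ?_).trans hn⟩
      -- The sup norm is at most the Euclidean norm, so the tail bound carries over.
      exact le_trans (show K ≤ _ from hω) ((pi_norm_le_iff_of_nonneg (norm_nonneg _)).2 fun q =>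
        PiLp.norm_apply_le (√(n : ℝ) • WithLp.toLp 2 (Matrix.vec (empPMF X Y n ω - p))) q)
  refine ⟨isUnit_Lmat (hu θ₀ hθ₀) (hupos θ₀ hθ₀), hF, hlin, fun hind => ?_⟩
  -- The identity matrix gives the weak convergence that the linear representation presupposes; the
  -- second use gives the limit of its leading term, and Slutsky's lemma combines them.
  have hZ := tendstoInDistribution_mulVec_empPMF hX hY hXY hind
    (1 : Matrix (Fin (S + 1) × Fin (R + 1)) (Fin (S + 1) × Fin (R + 1)) ℝ)
  simp only [Matrix.one_mulVec, Matrix.one_mul, Matrix.transpose_one, Matrix.mul_one,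
    WithLp.toLp_smul] at hZ
  have hW := tendstoInDistribution_mulVec_empPMF hX hY hXY hind
    ((fisher u θ₀)⁻¹ * scoreMatrix u θ₀ * Jmat (u θ₀) p)
  simp only [Matrix.transpose_mul, ← Matrix.mul_assoc] at hW
  refine tendstoInDistribution_of_tendstoInMeasure_sub _ _ hW (hlin _ hZ) fun n => ?_
  exact (((hθmeas n).sub_const θ₀).const_smul (√(n : ℝ))).aemeasurable
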